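/- Let $K$ be a Lie group with Lie algebra $\mathfrak k$, let $\langle\cdot,\cdot\rangle$ be an inner product on $\mathfrak k$ that is invariant under the adjoint action (such an inner product exists whenever $K$ is compact), and let $\pi:P\to M$ be a smooth principal $K$-bundle over a smooth manifold $M$ (finite-dimensional, without boundary), with right action written $(p,g)\mapsto pg$. For $X\in\mathfrak k$ let $X^\#$ be the fundamental vector field on $P$. Let $A$ be a connection on $P$ with connection form $\omega_A$, horizontal spaces $A_p=\ker(\omega_A)_p$ and horizontal projection $\pi_A:TP\to A$, $\pi_A(w)=w-\omega_A(w)^\#$. For $u\in T_xM$ and $p\in\pi^{-1}(x)$ let $\tilde u\in A_p$ be the horizontal lift of $u$. Let $\alpha$ be a smooth tensorial $\mathfrak k$-valued 1-form of type $\mathrm{ad}$ on $P$ (it vanishes on vertical vectors and $R_g^*\alpha=\mathrm{ad}_{g^{-1}}\alpha$) such that $\alpha_p|_{A_p}:A_p\to\mathfrak k$ is an isomorphism for every $p\in P$. Let $\mathrm{ad}(P)=P\times_{\mathrm{ad}}\mathfrak k$ be the adjoint bundle, whose elements are the classes $[p;X]=[pg;\mathrm{ad}_{g^{-1}}X]$,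 with the Euclidean metric $h([p;X],[p;Y])=\langle X,Y\rangle$. Let ${}^\vee\alpha:TM\to\mathrm{ad}(P)$ be the isomorphism ${}^\vee\alpha(u)=[p;\alpha_p(\tilde u)]$. For a section $\sigma$ of $\mathrm{ad}(P)$ let ${}^\wedge\sigma:P\to\mathfrak k$ be the function with $[p;({}^\wedge\sigma)(p)]=\sigma(\pi(p))$, and let $\nabla^A$ be the linear connection on $\mathrm{ad}(P)$ induced by $A$, $$\nabla^A_u\sigma=[p;(d_A{}^\wedge\sigma)_p(\tilde u)],\qquad d_A=\pi_A^*\circ d .$$ Put $$g_\alpha(u,v)=h({}^\vee\alpha(u),{}^\vee\alpha(v)),\qquad \nabla=({}^\vee\alpha)^{-1}\circ\nabla^A\circ({}^\vee\alpha).$$ Then $g_\alpha$ is a smooth Riemannian metric on $M$, and $\nabla$ is a smooth linear connection on $TM$ that is compatible with $g_\alpha$. The torsion $T_\nabla$ vanishes if and only if $d_A\alpha=0$, where $d_A\alpha=d\alpha(\pi_A\cdot,\pi_A\cdot)$. If this is the case, then $\nabla$ is the Levi-Civita connection of $(M,g_\alpha)$, i.e. the unique connection on $TM$ that is compatible with $g_\alpha$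 and has vanishing torsion. -/

import Mathlib

open Bundle Set Filter Function
open scoped Manifold ContDiff Topology

noncomputable section

namespace PrincipalGeometry

variable
  {EK : Type*} [NormedAddCommGroup EK] [NormedSpace ℝ EK]
  {HK : Type*} [TopologicalSpace HK] {IK : ModelWithCorners ℝ EK HK}
  {K : Type*} [TopologicalSpace K] [ChartedSpace HK K] [Group K]
  {EP : Type*} [NormedAddCommGroup EP] [NormedSpace ℝ EP]
  {HP : Type*} [TopologicalSpace HP] {IP : ModelWithCorners ℝ EP HP}
  {P : Type*} [TopologicalSpace P] [ChartedSpace HP P]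
  {EM : Type*} [NormedAddCommGroup EM] [NormedSpace ℝ EM]
  {HM : Type*} [TopologicalSpace HM] {IM : ModelWithCorners ℝ EM HM}
  {M : Type*} [TopologicalSpace M] [ChartedSpace HM M]

/-! ### Adjoint representation

The Lie algebra `𝔨 = T₁K` of `K` (`GroupLieAlgebra IK K` in Mathlib) has the model vector space `EK`
as its underlying topological vector space; we write it as `EK`, so that `𝔨`-valued functions and
forms are functions and forms with values in a normed space. -/

variable (IK) in
/-- The adjoint representation `Ad g : 𝔨 → 𝔨`, the derivative at `1` of `h ↦ g h g⁻¹`. -/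
def Ad (g : K) : EK →L[ℝ] EK :=
  mfderiv IK IK (fun h : K => g * h * g⁻¹) 1

lemma hasMFDerivAt_conj [LieGroup IK ∞ K] (g h : K) (hh : h = 1) :
    HasMFDerivAt IK IK (fun h : K => g * h * g⁻¹) h (Ad (EK := EK) IK g) := by
  subst hh
  have : MDifferentiableAt IK IK (fun h : K => g * h * g⁻¹) 1 :=
    ((contMDiff_mul_right (I := IK) (n := ∞) (a := g⁻¹)).comp
      (contMDiff_mul_left (I := IK) (n := ∞) (a := g))).mdifferentiable (by simp) 1
  exact this.hasMFDerivAt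

lemma Ad_one (X : EK) : Ad IK (1 : K) X = X := by
  have : (fun h : K => 1 * h * 1⁻¹) = id := by ext; simp
  unfold Ad
  rw [this, mfderiv_id]
  rfl

lemma Ad_mul [LieGroup IK ∞ K] (g h : K) (X : EK) :
    Ad IK (g * h) X = Ad IK g (Ad IK h X) := by
  have h1 := (hasMFDerivAt_conj (IK := IK) g (h * 1 * h⁻¹) (by simp)).comp 1
    (hasMFDerivAt_conj (IK := IK) h 1 rfl)
  have h2 := hasMFDerivAt_conj (IK := IK) (g * h) 1 rfl
  have h3 : (fun k : K => g * h * k * (g * h)⁻¹)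
      = (fun k : K => g * k * g⁻¹) ∘ (fun k : K => h * k * h⁻¹) := by
    ext k; simp [mul_assoc]
  rw [h3] at h2
  exact congrArg (fun L : EK →L[ℝ] EK => L X) (hasMFDerivAt_unique h2 h1)

lemma Ad_inv_apply [LieGroup IK ∞ K] (g : K) (X : EK) : Ad IK g⁻¹ (Ad IK g X) = X := by
  rw [← Ad_mul, inv_mul_cancel, Ad_one]

lemma Ad_apply_inv [LieGroup IK ∞ K] (g : K) (X : EK) : Ad IK g (Ad IK g⁻¹ X) = X := by
  rw [← Ad_mul, mul_inv_cancel, Ad_one]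

variable (IK K) in
/-- An inner product on the Lie algebra `𝔨 = T₁K` that is invariant under the adjoint action. -/
structure AdInvariantInner where
  /-- the bilinear form `⟨X, Y⟩` -/
  form : EK →ₗ[ℝ] EK →ₗ[ℝ] ℝ
  symm : ∀ X Y, form X Y = form Y X
  pos : ∀ X, X ≠ 0 → 0 < form X X
  invariant : ∀ (g : K) (X Y : EK), form (Ad IK g X) (Ad IK g Y) = form X Y

/-! ### Principal bundles -/

variable (IK K IP P IM M) in
/-- The structure of a smooth principal `K`-bundle with total space `P` over `M`. -/
structure PrincipalBundle where
  /-- the projection `π : P → M` -/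
  proj : P → M
  /-- the right action `ρ : P × K → P` -/
  act : P → K → P
  act_one : ∀ p, act p 1 = p
  act_mul : ∀ p g h, act p (g * h) = act (act p g) h
  contMDiff_act : ContMDiff (IP.prod IK) IP ∞ (fun q : P × K => act q.1 q.2)
  proj_act : ∀ p g, proj (act p g) = proj p
  contMDiff_proj : ContMDiff IP IM ∞ proj
  /-- smooth equivariant local trivializations `π⁻¹(U) ≃ U × K` -/
  exists_trivialization : ∀ x : M, ∃ e : Trivialization K proj, x ∈ e.baseSet ∧
    ContMDiffOn IP (IM.prod IK) ∞ e e.source ∧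
    ContMDiffOn (IM.prod IK) IP ∞ e.toOpenPartialHomeomorph.symm e.target ∧
    ∀ p ∈ e.source, ∀ g, e (act p g) = ((e p).1, (e p).2 * g)

namespace PrincipalBundle

variable (B : PrincipalBundle IK K IP P IM M)

/-- The fibre `π⁻¹(x)`. -/
abbrev Fiber (x : M) : Type _ := {p : P // B.proj p = x}

lemma nonempty_fiber (x : M) : Nonempty (B.Fiber x) := by
  obtain ⟨e, hx, -⟩ := B.exists_trivialization x
  exact ⟨⟨e.toOpenPartialHomeomorph.symm (x, 1), e.proj_symm_apply' hx⟩⟩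

/-- A choice of a point in the fibre over `x`. The objects defined with it below do not depend on
the choice. -/
def basePoint (x : M) : B.Fiber x := Classical.choice (B.nonempty_fiber x)

/-- The right action on a fibre. -/
def fiberAct {x : M} (p : B.Fiber x) (g : K) : B.Fiber x :=
  ⟨B.act p.1 g, (B.proj_act _ _).trans p.2⟩

lemma exists_unique_act {x : M} (p q : B.Fiber x) : ∃! g, B.fiberAct p g = q := by
  obtain ⟨e, hx, -, -, he⟩ := B.exists_trivialization x
  have hp : p.1 ∈ e.source := by rw [e.mem_source, p.2]; exact hx
  have hq : q.1 ∈ e.source := by rw [e.mem_source, q.2]; exact hx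
  have key : ∀ g, B.fiberAct p g = q ↔ (e p.1).2 * g = (e q.1).2 := by
    intro g
    have hpg : B.act p.1 g ∈ e.source := by rw [e.mem_source, B.proj_act, p.2]; exact hx
    have h1 : (e p.1).1 = (e q.1).1 := by rw [e.coe_fst hp, e.coe_fst hq, p.2, q.2]
    constructor
    · intro h
      rw [← h]
      simp [fiberAct, he _ hp]
    · intro h
      apply Subtype.ext
      apply e.injOn hpg hq
      change e (B.act p.1 g) = e q.1
      rw [he _ hp]
      exact Prod.ext h1 h
  refine ⟨(e p.1).2⁻¹ * (e q.1).2, (key _).2 (by group), fun g hg => ?_⟩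
  rw [← (key g).1 hg]; group

/-- The fundamental vector field `X ↦ X^#`: the derivative at `1 ∈ K` of `g ↦ p g`. -/
def fundamental (p : P) : EK →L[ℝ] TangentSpace IP p :=
  mfderiv IK IP (B.act p) 1

/-- The derivative of `R_g : p ↦ p g`. -/
def dR (g : K) (p : P) : TangentSpace IP p →L[ℝ] TangentSpace IP (B.act p g) :=
  mfderiv IP IP (fun q => B.act q g) p

/-- The derivative of `π` at a point of the fibre over `x`. -/
def dproj {x : M} (p : B.Fiber x) : TangentSpace IP p.1 →L[ℝ] TangentSpace IM x :=
  mfderiv IP IM B.proj p.1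

lemma mdifferentiable_proj : MDifferentiable IP IM B.proj :=
  B.contMDiff_proj.mdifferentiable (by simp)

lemma mdifferentiable_act_left (p : P) : MDifferentiable IK IP (B.act p) := by
  have : ContMDiff IK (IP.prod IK) ∞ (fun g : K => (p, g)) :=
    contMDiff_const.prodMk contMDiff_id
  exact (B.contMDiff_act.comp this).mdifferentiable (by simp)

lemma mdifferentiable_act_right (g : K) : MDifferentiable IP IP (fun p => B.act p g) := by
  have : ContMDiff IP (IP.prod IK) ∞ (fun p : P => (p, g)) :=
    contMDiff_id.prodMk contMDiff_const
  exact (B.contMDiff_act.comp this).mdifferentiable (by simp)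

/-- Fundamental vector fields are vertical. -/
lemma dproj_fundamental {x : M} (p : B.Fiber x) (X : EK) :
    B.dproj p (B.fundamental p.1 X) = 0 := by
  have h1 : HasMFDerivAt IK IP (B.act p.1) 1 (B.fundamental p.1) :=
    (B.mdifferentiable_act_left p.1 1).hasMFDerivAt
  have h2 : HasMFDerivAt IP IM B.proj (B.act p.1 1) (B.dproj p) := by
    rw [B.act_one]
    exact (B.mdifferentiable_proj p.1).hasMFDerivAt
  have h3 := h2.comp 1 h1
  have h4 : B.proj ∘ B.act p.1 = fun _ => x := by
    ext g; simp [B.proj_act, p.2]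
  rw [h4] at h3
  exact congrArg (fun L : EK →L[ℝ] EM => L X)
    (hasMFDerivAt_unique h3 (hasMFDerivAt_const x (1 : K)))

/-- Through every point there is a smooth local section `s`, and near the point every `q ∈ P` is
`s (π q) c(q)` for a differentiable `c`. -/
lemma exists_local_section [LieGroup IK ∞ K] {x : M} (p : B.Fiber x) : ∃ (s : M → P) (c : P → K),
    MDifferentiableAt IM IP s x ∧ s x = p.1 ∧ (∀ᶠ y in 𝓝 x, B.proj (s y) = y) ∧
    MDifferentiableAt IP IK c p.1 ∧ c p.1 = 1 ∧
    ∀ᶠ q in 𝓝 p.1, B.act (s (B.proj q)) (c q) = q := by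
  obtain ⟨e, hx, he, hes, hact⟩ := B.exists_trivialization x
  have hp : p.1 ∈ e.source := by rw [e.mem_source, p.2]; exact hx
  have hep : e p.1 = (x, (e p.1).2) := Prod.ext ((e.coe_fst hp).trans p.2) rfl
  set k := (e p.1).2 with hk
  have hsource : ∀ y ∈ e.baseSet, e.toOpenPartialHomeomorph.symm (y, k) ∈ e.source := fun y hy =>
    e.toOpenPartialHomeomorph.map_target (e.mem_target.2 hy)
  have hes' : ∀ y ∈ e.baseSet, e (e.toOpenPartialHomeomorph.symm (y, k)) = (y, k) := fun y hy =>
    e.apply_symm_apply (e.mem_target.2 hy)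
  have hproj : ∀ y ∈ e.baseSet, B.proj (e.toOpenPartialHomeomorph.symm (y, k)) = y := fun y hy =>
    e.proj_symm_apply' hy
  refine ⟨fun y => e.toOpenPartialHomeomorph.symm (y, k), fun q => k⁻¹ * (e q).2, ?_, ?_, ?_,
    ?_, ?_, ?_⟩
  · have h1 : MDifferentiableAt (IM.prod IK) IP e.toOpenPartialHomeomorph.symm (x, k) :=
      (hes.contMDiffAt (e.open_target.mem_nhds (e.mem_target.2 hx))).mdifferentiableAt (by simp)
    exact MDifferentiableAt.comp x h1 (mdifferentiableAt_id.prodMk mdifferentiableAt_const)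
  · change e.toOpenPartialHomeomorph.symm (x, k) = p.1
    rw [← hep]
    exact e.toOpenPartialHomeomorph.left_inv hp
  · filter_upwards [e.open_baseSet.mem_nhds hx] with y hy using hproj y hy
  · have h1 : MDifferentiableAt IP (IM.prod IK) e p.1 :=
      (he.contMDiffAt (e.open_source.mem_nhds hp)).mdifferentiableAt (by simp)
    have h2 : MDifferentiableAt IK IK (fun h : K => k⁻¹ * h) (e p.1).2 :=
      (contMDiff_mul_left (I := IK) (n := ∞) (a := k⁻¹)).mdifferentiable (by simp) _
    exact h2.comp p.1 (MDifferentiableAt.comp p.1 mdifferentiableAt_snd h1)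
  · simp [hk]
  · filter_upwards [e.open_source.mem_nhds hp] with q hq
    have hq' : B.proj q ∈ e.baseSet := e.mem_source.1 hq
    apply e.injOn _ hq
    · change e (B.act _ _) = e q
      rw [hact _ (hsource _ hq'), hes' _ hq']
      exact Prod.ext (e.coe_fst hq).symm (by simp)
    · rw [e.mem_source, B.proj_act, hproj _ hq']
      exact hq'

/-- `π` is a submersion. -/
lemma dproj_surjective [LieGroup IK ∞ K] {x : M} (p : B.Fiber x) : Surjective (B.dproj p) := by
  obtain ⟨s, -, hs, hsx, hs', -⟩ := B.exists_local_section p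
  intro u
  have h2 : HasMFDerivAt IP IM B.proj (s x) (B.dproj p) := by
    rw [hsx]
    exact (B.mdifferentiable_proj p.1).hasMFDerivAt
  have h3 := h2.comp x hs.hasMFDerivAt
  have h4 : HasMFDerivAt IM IM (B.proj ∘ s) x (ContinuousLinearMap.id ℝ EM) :=
    (hasMFDerivAt_id x).congr_of_eventuallyEq hs'
  exact ⟨mfderiv IM IP s x u,
    congrArg (fun L : EM →L[ℝ] EM => L u) (hasMFDerivAt_unique h3 h4)⟩

/-- Vertical vectors are values of fundamental vector fields. -/
lemma exists_fundamental_eq [LieGroup IK ∞ K] {x : M} (p : B.Fiber x) (w : TangentSpace IP p.1)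
    (hw : B.dproj p w = 0) : ∃ X, B.fundamental p.1 X = w := by
  obtain ⟨s, c, hs, hsx, -, hc, hc1, hsc⟩ := B.exists_local_section p
  have hF : MDifferentiableAt (IM.prod IK) IP (fun q : M × K => B.act (s q.1) q.2) (x, 1) := by
    have h1 : MDifferentiableAt (IP.prod IK) IP (fun q : P × K => B.act q.1 q.2) (s x, 1) :=
      B.contMDiff_act.mdifferentiable (by simp) _
    have h2 : MDifferentiableAt (IM.prod IK) (IP.prod IK)
        (fun q : M × K => (s q.1, q.2)) (x, 1) :=
      (MDifferentiableAt.comp (x, (1 : K)) hs mdifferentiableAt_fst).prodMk mdifferentiableAt_snd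
    exact MDifferentiableAt.comp (x, (1 : K)) h1 h2
  have hG : HasMFDerivAt IP (IM.prod IK) (fun q => (B.proj q, c q)) p.1
      ((B.dproj p).prod (mfderiv IP IK c p.1)) :=
    (B.mdifferentiable_proj p.1).hasMFDerivAt.prodMk hc.hasMFDerivAt
  have hF' : HasMFDerivAt (IM.prod IK) IP (fun q : M × K => B.act (s q.1) q.2)
      (B.proj p.1, c p.1)
      (mfderiv (IM.prod IK) IP (fun q : M × K => B.act (s q.1) q.2) (x, 1)) := by
    rw [p.2, hc1]
    exact hF.hasMFDerivAt
  have h3 := hF'.comp p.1 hG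
  have h4 : HasMFDerivAt IP IP ((fun q : M × K => B.act (s q.1) q.2) ∘
      (fun q => (B.proj q, c q))) p.1 (ContinuousLinearMap.id ℝ EP) :=
    (hasMFDerivAt_id p.1).congr_of_eventuallyEq hsc
  have h5 : mfderiv (IM.prod IK) IP (fun q : M × K => B.act (s q.1) q.2) (x, 1)
      ((B.dproj p w, mfderiv IP IK c p.1 w) : EM × EK) = w :=
    congrArg (fun L : EP →L[ℝ] EP => L w) (hasMFDerivAt_unique h3 h4)
  refine ⟨mfderiv IP IK c p.1 w, ?_⟩
  rw [hw] at h5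
  have h6 := mfderiv_prod_eq_add_apply hF (v := ((0, mfderiv IP IK c p.1 w) : EM × EK))
  have h7 : ∀ q, s x = q →
      (mfderiv IK IP (fun z : K => B.act (s x) z) 1 : EK →L[ℝ] EP) = B.fundamental q := by
    rintro _ rfl; rfl
  refine Eq.trans ?_ (h6.symm.trans h5)
  refine (Eq.trans ?_ (zero_add _).symm).trans (congrArg (· + _) (map_zero _).symm)
  exact congrArg (fun L : EK →L[ℝ] EP => L (mfderiv IP IK c p.1 w)) (h7 _ hsx).symm

lemma dproj_dR {x : M} (p : B.Fiber x) (g : K) (w : TangentSpace IP p.1) :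
    B.dproj (B.fiberAct p g) (B.dR g p.1 w) = B.dproj p w := by
  have h1 : HasMFDerivAt IP IP (fun q => B.act q g) p.1 (B.dR g p.1) :=
    (B.mdifferentiable_act_right g p.1).hasMFDerivAt
  have h2 : HasMFDerivAt IP IM B.proj (B.act p.1 g) (B.dproj (B.fiberAct p g)) :=
    (B.mdifferentiable_proj (B.act p.1 g)).hasMFDerivAt
  have h3 := h2.comp p.1 h1
  have h4 : B.proj ∘ (fun q => B.act q g) = B.proj := by
    ext q; simp [B.proj_act]
  rw [h4] at h3
  exact congrArg (fun L : EP →L[ℝ] EM => L w)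
    (hasMFDerivAt_unique h3 (B.mdifferentiable_proj p.1).hasMFDerivAt)

/-! ### The adjoint bundle `ad(P) = P ×_Ad 𝔨` -/

/-- The equivalence relation `(p, X) ∼ (p g, Ad(g⁻¹) X)` on the part of `P × 𝔨` over `x`. -/
def adSetoid [LieGroup IK ∞ K] (x : M) : Setoid (B.Fiber x × EK) where
  r a b := ∃ g : K, b.1 = B.fiberAct a.1 g ∧ b.2 = Ad IK g⁻¹ a.2
  iseqv := by
    refine ⟨fun a => ⟨1, Subtype.ext (B.act_one _).symm, by rw [inv_one, Ad_one]⟩, ?_, ?_⟩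
    · rintro a b ⟨g, h1, h2⟩
      refine ⟨g⁻¹, ?_, ?_⟩
      · rw [h1]
        apply Subtype.ext
        simp [fiberAct, ← B.act_mul, B.act_one]
      · rw [h2, inv_inv, Ad_apply_inv]
    · rintro a b c ⟨g, h1, h2⟩ ⟨h, h3, h4⟩
      refine ⟨g * h, ?_, ?_⟩
      · rw [h3, h1]
        apply Subtype.ext
        simp [fiberAct, ← B.act_mul]
      · rw [h4, h2, mul_inv_rev, Ad_mul]

/-- The fibre `ad(P)_x` of the adjoint bundle. -/
def AdFiber [LieGroup IK ∞ K] (x : M) : Type _ := Quotient (B.adSetoid x)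

variable [LieGroup IK ∞ K]

/-- The class `[p; X] ∈ ad(P)_x`. -/
def adMk {x : M} (p : B.Fiber x) (X : EK) : B.AdFiber x := Quotient.mk (B.adSetoid x) (p, X)

lemma adMk_fiberAct {x : M} (p : B.Fiber x) (g : K) (X : EK) :
    B.adMk (B.fiberAct p g) (Ad IK g⁻¹ X) = B.adMk p X :=
  (Quotient.sound (s := B.adSetoid x) ⟨g, rfl, rfl⟩).symm

lemma adMk_bijective {x : M} (p : B.Fiber x) : Bijective (B.adMk p) := by
  constructor
  · intro X Y h
    obtain ⟨g, h1, h2⟩ := Quotient.exact h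
    have hg : g = 1 := (B.exists_unique_act p p).unique h1.symm (Subtype.ext (B.act_one _))
    simpa [hg, Ad_one] using h2.symm
  · intro a
    induction a using Quotient.inductionOn with
    | h a =>
      obtain ⟨q, Y⟩ := a
      obtain ⟨g, hg, -⟩ := B.exists_unique_act p q
      refine ⟨Ad IK g Y, ?_⟩
      rw [← B.adMk_fiberAct p g, Ad_inv_apply, hg]
      rfl

/-- The bijection `𝔨 ≃ ad(P)_x`, `X ↦ [p; X]`. -/
def adMkEquiv {x : M} (p : B.Fiber x) : EK ≃ B.AdFiber x :=
  Equiv.ofBijective _ (B.adMk_bijective p)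

/-- The vector space structure on `ad(P)_x` for which `X ↦ [p; X]` is linear for all `p`
(see `adMkₗ`). -/
instance (x : M) : AddCommGroup (B.AdFiber x) := (B.adMkEquiv (B.basePoint x)).symm.addCommGroup

instance (x : M) : Module ℝ (B.AdFiber x) := (B.adMkEquiv (B.basePoint x)).symm.module ℝ

lemma exists_adMk_eq {x : M} (p q : B.Fiber x) :
    ∃ g : K, ∀ X, B.adMk q X = B.adMk p (Ad IK g X) := by
  obtain ⟨g, hg, -⟩ := B.exists_unique_act p q
  refine ⟨g, fun X => ?_⟩
  rw [← B.adMk_fiberAct p g, Ad_inv_apply, hg]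

lemma basePoint_add (x : M) (X Y : EK) :
    B.adMk (B.basePoint x) (X + Y) = B.adMk (B.basePoint x) X + B.adMk (B.basePoint x) Y := by
  change B.adMkEquiv (B.basePoint x) (X + Y) = _
  rw [← (B.adMkEquiv (B.basePoint x)).symm_apply_apply X,
    ← (B.adMkEquiv (B.basePoint x)).symm_apply_apply Y]
  simp only [Equiv.symm_apply_apply]
  change _ = B.adMkEquiv (B.basePoint x) (_ + _)
  congr 2
  · exact ((B.adMkEquiv (B.basePoint x)).symm_apply_apply X).symm
  · exact ((B.adMkEquiv (B.basePoint x)).symm_apply_apply Y).symm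

lemma basePoint_smul (x : M) (c : ℝ) (X : EK) :
    B.adMk (B.basePoint x) (c • X) = c • B.adMk (B.basePoint x) X := by
  change _ = B.adMkEquiv (B.basePoint x) (c • _)
  change B.adMkEquiv (B.basePoint x) (c • X) = _
  congr 2
  exact ((B.adMkEquiv (B.basePoint x)).symm_apply_apply X).symm

/-- The linear isomorphism `𝔨 ≃ ad(P)_x`, `X ↦ [p; X]`. -/
def adMkₗ {x : M} (p : B.Fiber x) : EK ≃ₗ[ℝ] B.AdFiber x :=
  LinearEquiv.ofBijective (M := EK) (M₂ := B.AdFiber x)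
    { toFun := B.adMk p
      map_add' := fun X Y => by
        obtain ⟨g, hg⟩ := B.exists_adMk_eq (B.basePoint x) p
        rw [hg, hg, hg, map_add, basePoint_add]
      map_smul' := fun c X => by
        obtain ⟨g, hg⟩ := B.exists_adMk_eq (B.basePoint x) p
        rw [hg, hg, map_smul, basePoint_smul, RingHom.id_apply] }
    (B.adMk_bijective p)

@[simp] lemma adMkₗ_apply {x : M} (p : B.Fiber x) (X : EK) : B.adMkₗ p X = B.adMk p X := rfl

/-- The Euclidean metric `h([p; X], [p; Y]) = ⟨X, Y⟩` on `ad(P)`. -/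
def adMetric (κ : AdInvariantInner IK K) (x : M) : B.AdFiber x →ₗ[ℝ] B.AdFiber x →ₗ[ℝ] ℝ :=
  κ.form.compl₁₂ (B.adMkₗ (B.basePoint x)).symm.toLinearMap (B.adMkₗ (B.basePoint x)).symm.toLinearMap

lemma adMetric_adMk (κ : AdInvariantInner IK K) {x : M} (p : B.Fiber x) (X Y : EK) :
    B.adMetric κ x (B.adMk p X) (B.adMk p Y) = κ.form X Y := by
  obtain ⟨g, hg⟩ := B.exists_adMk_eq (B.basePoint x) p
  rw [hg, hg, ← adMkₗ_apply, ← adMkₗ_apply, adMetric, LinearMap.compl₁₂_apply]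
  simp only [LinearEquiv.coe_coe, LinearEquiv.symm_apply_apply]
  exact κ.invariant g X Y

end PrincipalBundle

/-! ### Connections and tensorial forms -/

variable [IsManifold IP ∞ P]

/-- A connection on a principal bundle, given by its connection 1-form `ω : TP → 𝔨`. -/
structure Connection (B : PrincipalBundle IK K IP P IM M) where
  form : (p : P) → TangentSpace IP p →L[ℝ] EK
  contMDiff : ContMDiff IP.tangent 𝓘(ℝ, EK) ∞ (fun v : TangentBundle IP P => form v.proj v.2)
  form_fundamental : ∀ p X, form p (B.fundamental p X) = X
  form_dR : ∀ p g w, form (B.act p g) (B.dR g p w) = Ad IK g⁻¹ (form p w)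

/-- A smooth tensorial `𝔨`-valued 1-form of type `Ad` on `P`, i.e. an element of `A¹_ad(P, 𝔨)`. -/
structure TensorialOneForm (B : PrincipalBundle IK K IP P IM M) where
  form : (p : P) → TangentSpace IP p →L[ℝ] EK
  contMDiff : ContMDiff IP.tangent 𝓘(ℝ, EK) ∞ (fun v : TangentBundle IP P => form v.proj v.2)
  form_vertical : ∀ p w, mfderiv IP IM B.proj p w = 0 → form p w = 0
  form_dR : ∀ p g w, form (B.act p g) (B.dR g p w) = Ad IK g⁻¹ (form p w)

namespace Connection

variable {B : PrincipalBundle IK K IP P IM M} (A : Connection B)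

/-- The horizontal space `A_p = ker ω_p`. -/
abbrev horizontal (p : P) : Submodule ℝ (TangentSpace IP p) := (A.form p).ker

/-- The projection `π_A : TP → A` along the vertical bundle. -/
def horizontalProj (p : P) : TangentSpace IP p →L[ℝ] TangentSpace IP p :=
  ContinuousLinearMap.id ℝ (TangentSpace IP p) - (B.fundamental p).comp (A.form p)

lemma horizontalProj_mem (p : P) (w : TangentSpace IP p) :
    A.horizontalProj p w ∈ A.horizontal p := by
  change A.form p (w - B.fundamental p (A.form p w)) = 0
  rw [map_sub, A.form_fundamental, sub_self]

/-- `α` restricts to an isomorphism `A_p → 𝔨` for each `p`. -/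
def IsIsoOnHorizontal (α : TensorialOneForm B) : Prop :=
  ∀ p, Bijective (fun w : A.horizontal p => α.form p w)

variable [LieGroup IK ∞ K]

lemma dproj_bijective {x : M} (p : B.Fiber x) :
    Bijective ((B.dproj p).toLinearMap.domRestrict (A.horizontal p.1)) := by
  constructor
  · rw [injective_iff_map_eq_zero]
    rintro ⟨w, hw⟩ h
    obtain ⟨X, rfl⟩ := B.exists_fundamental_eq p w h
    have hX : X = 0 := (A.form_fundamental p.1 X).symm.trans hw
    exact Subtype.ext (by simp [hX])
  · intro u
    obtain ⟨w, rfl⟩ := B.dproj_surjective p u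
    refine ⟨⟨A.horizontalProj p.1 w, A.horizontalProj_mem p.1 w⟩, ?_⟩
    change B.dproj p (w - B.fundamental p.1 (A.form p.1 w)) = _
    rw [map_sub, B.dproj_fundamental, sub_zero]

/-- `π_*` restricts to an isomorphism `A_p → T_xM`, for `p` over `x`. -/
def dprojEquiv {x : M} (p : B.Fiber x) : A.horizontal p.1 ≃ₗ[ℝ] TangentSpace IM x :=
  LinearEquiv.ofBijective _ (A.dproj_bijective p)

/-- The horizontal lift of `u ∈ T_xM` to `p` over `x`. -/
def horizontalLift {x : M} (p : B.Fiber x) : TangentSpace IM x →ₗ[ℝ] TangentSpace IP p.1 :=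
  (A.horizontal p.1).subtype ∘ₗ (A.dprojEquiv p).symm.toLinearMap

lemma form_horizontalLift {x : M} (p : B.Fiber x) (u : TangentSpace IM x) :
    A.form p.1 (A.horizontalLift p u) = 0 :=
  ((A.dprojEquiv p).symm u).2

lemma dproj_horizontalLift {x : M} (p : B.Fiber x) (u : TangentSpace IM x) :
    B.dproj p (A.horizontalLift p u) = u :=
  (A.dprojEquiv p).apply_symm_apply u

lemma eq_of_dproj_eq {x : M} (p : B.Fiber x) {v w : TangentSpace IP p.1}
    (hv : A.form p.1 v = 0) (hw : A.form p.1 w = 0) (h : B.dproj p v = B.dproj p w) : v = w :=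
  congrArg Subtype.val (@(A.dproj_bijective p).1 ⟨v, hv⟩ ⟨w, hw⟩ h)

lemma horizontalLift_fiberAct {x : M} (p : B.Fiber x) (g : K) (u : TangentSpace IM x) :
    A.horizontalLift (B.fiberAct p g) u = B.dR g p.1 (A.horizontalLift p u) := by
  refine A.eq_of_dproj_eq (B.fiberAct p g) (A.form_horizontalLift _ _) ?_ ?_
  · exact (A.form_dR p.1 g _).trans (by rw [form_horizontalLift, map_zero])
  · rw [B.dproj_dR, dproj_horizontalLift, dproj_horizontalLift]

/-- The map `∨` from `𝔨`-valued 1-forms of type `Ad` on `P` to `ad(P)`-valued 1-forms on `M`: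
`(∨β)_x(u) = [p; β_p(ũ)]`, where `ũ` is the horizontal lift of `u` to a point `p` over `x`. -/
def vee (β : (p : P) → TangentSpace IP p →L[ℝ] EK) (x : M) :
    TangentSpace IM x →ₗ[ℝ] B.AdFiber x :=
  (B.adMkₗ (B.basePoint x)).toLinearMap ∘ₗ (β (B.basePoint x).1).toLinearMap ∘ₗ
    A.horizontalLift (B.basePoint x)

/-- For forms of type `Ad`, `∨` does not depend on the choice of the point in the fibre. -/
lemma vee_apply (β : (p : P) → TangentSpace IP p →L[ℝ] EK)
    (hβ : ∀ p g w, β (B.act p g) (B.dR g p w) = Ad IK g⁻¹ (β p w))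
    {x : M} (p : B.Fiber x) (u : TangentSpace IM x) :
    A.vee β x u = B.adMk p (β p.1 (A.horizontalLift p u)) := by
  obtain ⟨g, hg, -⟩ := B.exists_unique_act (B.basePoint x) p
  subst hg
  rw [horizontalLift_fiberAct]
  refine Eq.trans ?_ (congrArg (B.adMk _) (hβ _ g _).symm)
  rw [B.adMk_fiberAct]
  rfl

/-- The map `∧` on sections of `ad(P)`: the function `∧σ : P → 𝔨` with `[p; (∧σ)(p)] = σ(π(p))`. -/
def wedge (σ : (x : M) → B.AdFiber x) (p : P) : EK :=
  (B.adMkₗ (⟨p, rfl⟩ : B.Fiber (B.proj p))).symm (σ (B.proj p))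

/-- The differential `d_A f = π_A^* df` of a `𝔨`-valued function on `P`. -/
def dFun (f : P → EK) (p : P) : TangentSpace IP p →L[ℝ] EK :=
  (mvfderiv IP f p).comp (A.horizontalProj p)

lemma horizontalProj_dR (p : P) (g : K) (w : TangentSpace IP p) :
    A.horizontalProj (B.act p g) (B.dR g p w) = B.dR g p (A.horizontalProj p w) := by
  let q : B.Fiber (B.proj p) := ⟨p, rfl⟩
  have h (q : P) (w : TangentSpace IP q) : A.form q (A.horizontalProj q w) = 0 :=
    A.horizontalProj_mem q w
  have h' {x : M} (q : B.Fiber x) (w : TangentSpace IP q.1) :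
      B.dproj q (A.horizontalProj q.1 w) = B.dproj q w := by
    change B.dproj q (w - B.fundamental q.1 (A.form q.1 w)) = _
    rw [map_sub, B.dproj_fundamental, sub_zero]
  refine A.eq_of_dproj_eq (B.fiberAct q g) (h _ _) ?_ ?_
  · exact (A.form_dR p g _).trans (by rw [h, map_zero])
  · refine (h' (B.fiberAct q g) _).trans ?_
    exact (B.dproj_dR q g w).trans ((h' q w).symm.trans (B.dproj_dR q g _).symm)

lemma wedge_act (σ : (x : M) → B.AdFiber x) (p : P) (g : K) :
    wedge σ (B.act p g) = Ad IK g⁻¹ (wedge σ p) := by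
  have key : ∀ (x : M) (hx : B.proj (B.act p g) = x) (hx' : B.proj p = x),
      (B.adMkₗ (⟨B.act p g, hx⟩ : B.Fiber x)).symm (σ x)
        = Ad IK g⁻¹ ((B.adMkₗ (⟨p, hx'⟩ : B.Fiber x)).symm (σ x)) := by
    intro x hx hx'
    rw [LinearEquiv.symm_apply_eq, B.adMkₗ_apply]
    refine Eq.trans ?_ (B.adMk_fiberAct (⟨p, hx'⟩ : B.Fiber x) g _).symm
    rw [← B.adMkₗ_apply, LinearEquiv.apply_symm_apply]
  have h := key _ (B.proj_act p g) rfl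
  rw [show wedge σ p = (B.adMkₗ (⟨p, rfl⟩ : B.Fiber (B.proj p))).symm (σ (B.proj p)) from rfl, ← h]
  unfold wedge
  have h2 : ∀ (x : M) (hx : B.proj (B.act p g) = x),
      (B.adMkₗ (⟨B.act p g, rfl⟩ : B.Fiber (B.proj (B.act p g)))).symm (σ (B.proj (B.act p g)))
        = (B.adMkₗ (⟨B.act p g, hx⟩ : B.Fiber x)).symm (σ x) := by
    rintro _ rfl; rfl
  exact h2 _ _

/-- `d_A(∧σ)` is of type `Ad`. -/
lemma dFun_wedge_dR (σ : (x : M) → B.AdFiber x) (p : P) (g : K) (w : TangentSpace IP p) :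
    A.dFun (wedge σ) (B.act p g) (B.dR g p w) = Ad IK g⁻¹ (A.dFun (wedge σ) p w) := by
  change mvfderiv IP (wedge σ) (B.act p g) (A.horizontalProj (B.act p g) (B.dR g p w))
    = Ad IK g⁻¹ (mvfderiv IP (wedge σ) p (A.horizontalProj p w))
  rw [horizontalProj_dR]
  generalize A.horizontalProj p w = v
  have hlin (h : K) (Y : EK) : HasMFDerivAt 𝓘(ℝ, EK) 𝓘(ℝ, EK) (Ad IK h : EK →L[ℝ] EK) Y
      (Ad IK h : EK →L[ℝ] EK) := (Ad IK h : EK →L[ℝ] EK).hasFDerivAt.hasMFDerivAt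
  have hR : HasMFDerivAt IP IP (fun q => B.act q g) p (B.dR g p) :=
    (B.mdifferentiable_act_right g p).hasMFDerivAt
  have h1 : wedge σ ∘ (fun q => B.act q g) = (Ad IK g⁻¹ : EK →L[ℝ] EK) ∘ wedge σ := by
    ext q; exact wedge_act σ q g
  by_cases hf : MDifferentiableAt IP 𝓘(ℝ, EK) (wedge σ) (B.act p g)
  · have h2 := hf.hasMFDerivAt.comp p hR
    have h3 : MDifferentiableAt IP 𝓘(ℝ, EK) (wedge σ) p := by
      have h4 : wedge σ = (Ad IK g : EK →L[ℝ] EK) ∘ (wedge σ ∘ (fun q => B.act q g)) := by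
        rw [h1]; ext q; simp [Ad_apply_inv]
      rw [h4]
      exact ((hlin g _).comp p h2).mdifferentiableAt
    have h5 := (hlin g⁻¹ (wedge σ p)).comp p h3.hasMFDerivAt
    rw [h1] at h2
    exact congrArg (fun L : EP →L[ℝ] EK => L v) (hasMFDerivAt_unique h2 h5)
  · have h3 : ¬ MDifferentiableAt IP 𝓘(ℝ, EK) (wedge σ) p := by
      intro h3
      apply hf
      have hR' : MDifferentiableAt IP IP (fun q => B.act q g⁻¹) (B.act p g) :=
        B.mdifferentiable_act_right g⁻¹ _
      have h4 : wedge σ = ((Ad IK g⁻¹ : EK →L[ℝ] EK) ∘ wedge σ) ∘ (fun q => B.act q g⁻¹) := by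
        ext q
        simp [← wedge_act, ← B.act_mul, B.act_one]
      have h6 : MDifferentiableAt IP 𝓘(ℝ, EK) (wedge σ) (B.act (B.act p g) g⁻¹) := by
        rwa [← B.act_mul, mul_inv_cancel, B.act_one]
      rw [h4]
      exact MDifferentiableAt.comp (B.act p g)
        (((hlin g⁻¹ _).mdifferentiableAt).comp _ h6) hR'
    simp [mvfderiv, mfderiv_zero_of_not_mdifferentiableAt hf,
      mfderiv_zero_of_not_mdifferentiableAt h3]

/-- The linear connection `∇^A = ∨ ∘ d_A ∘ ∧` on `ad(P)`: for a section `σ`, a point `x` and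
`u ∈ T_xM` it gives `∇^A_u σ ∈ ad(P)_x`. -/
def nablaAd (σ : (x : M) → B.AdFiber x) (x : M) : TangentSpace IM x →ₗ[ℝ] B.AdFiber x :=
  A.vee (A.dFun (wedge σ)) x

/-- `∇^A_u σ = [p; d(∧σ)_p(ũ)]` for every `p` over `x`. -/
lemma nablaAd_apply (σ : (x : M) → B.AdFiber x) {x : M} (p : B.Fiber x) (u : TangentSpace IM x) :
    A.nablaAd σ x u = B.adMk p (mvfderiv IP (wedge σ) p.1 (A.horizontalLift p u)) := by
  refine (A.vee_apply _ (A.dFun_wedge_dR σ) p u).trans ?_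
  change B.adMk p (mvfderiv IP (wedge σ) p.1 (A.horizontalLift p u
    - B.fundamental p.1 (A.form p.1 (A.horizontalLift p u)))) = _
  rw [form_horizontalLift, map_zero, sub_zero]

variable {A} in
/-- The isomorphism `∨α : TM → ad(P)`. -/
def veeEquiv {α : TensorialOneForm B} (hα : A.IsIsoOnHorizontal α) (x : M) :
    TangentSpace IM x ≃ₗ[ℝ] B.AdFiber x :=
  LinearEquiv.ofBijective (A.vee α.form x)
    ((B.adMkₗ (B.basePoint x)).bijective.comp
      ((hα (B.basePoint x).1).comp (A.dprojEquiv (B.basePoint x)).symm.bijective))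

lemma veeEquiv_apply {α : TensorialOneForm B} (hα : A.IsIsoOnHorizontal α) {x : M}
    (p : B.Fiber x) (u : TangentSpace IM x) :
    veeEquiv hα x u = B.adMk p (α.form p.1 (A.horizontalLift p u)) :=
  A.vee_apply α.form α.form_dR p u

variable {A} in
/-- The metric `g_α` on `M`, the pull-back of the metric on `ad(P)` along `∨α`. -/
def pullbackMetric {α : TensorialOneForm B} (hα : A.IsIsoOnHorizontal α)
    (κ : AdInvariantInner IK K) (x : M) (u v : TangentSpace IM x) : ℝ :=
  B.adMetric κ x (veeEquiv hα x u) (veeEquiv hα x v)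

variable {A} in
/-- The connection `∇ = (∨α)⁻¹ ∘ ∇^A ∘ ∨α` on `TM`. -/
def pullbackNabla {α : TensorialOneForm B} (hα : A.IsIsoOnHorizontal α)
    (X : (x : M) → TangentSpace IM x) (x : M) : TangentSpace IM x →ₗ[ℝ] TangentSpace IM x :=
  (veeEquiv hα x).symm.toLinearMap ∘ₗ A.nablaAd (fun y => veeEquiv hα y (X y)) x

end Connection

/-! ### Exterior derivatives -/

section ExtDeriv

variable {F : Type*} [NormedAddCommGroup F] [NormedSpace ℝ F]

/-- The expression `V(β(W)) - W(β(V)) - β([V, W])` at `p`, for vector fields `V`, `W`. -/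
def extDerivAux (β : (p : P) → TangentSpace IP p →L[ℝ] F) (p : P)
    (V W : (q : P) → TangentSpace IP q) : F :=
  mvfderiv IP (fun q => β q (W q)) p (V p) - mvfderiv IP (fun q => β q (V q)) p (W p)
    - β p (VectorField.mlieBracket IP V W p)

lemma extDerivAux_swap (β : (p : P) → TangentSpace IP p →L[ℝ] F) (p : P)
    (V W : (q : P) → TangentSpace IP q) : extDerivAux β p V W = - extDerivAux β p W V := by
  unfold extDerivAux
  rw [VectorField.mlieBracket_swap_apply, map_neg]
  abel

lemma tensorialAt_extDerivAux [FiniteDimensional ℝ EP] (β : (p : P) → TangentSpace IP p →L[ℝ] F)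
    (hβ : ContMDiff IP.tangent 𝓘(ℝ, F) ∞ (fun v : TangentBundle IP P => β v.proj v.2)) (p : P)
    (V : (q : P) → TangentSpace IP q) :
    TensorialAt IP EP (extDerivAux β p V) p := by
  have hd (W : (q : P) → TangentSpace IP q)
      (hW : MDifferentiableAt IP IP.tangent (fun q => (⟨q, W q⟩ : TangentBundle IP P)) p) :
      MDifferentiableAt IP 𝓘(ℝ, F) (fun q => β q (W q)) p :=
    MDifferentiableAt.comp p (hβ.mdifferentiable (by simp) _) hW
  constructor
  · intro f W hf hW
    have h1 : mvfderiv IP (fun q => β q ((f • W) q)) p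
        = f p • mvfderiv IP (fun q => β q (W q)) p + (mvfderiv IP f p).smulRight (β p (W p)) := by
      rw [← mvfderiv_smul hf (hd W hW)]
      congr 1
      ext q
      simp
    unfold extDerivAux
    rw [h1, VectorField.mlieBracket_smul_right hf hW]
    simp only [Pi.smul_apply', map_smul, map_add, add_apply,
      smul_apply, ContinuousLinearMap.smulRight_apply]
    module
  · intro W W' hW hW'
    have h1 : mvfderiv IP (fun q => β q ((W + W') q)) p
        = mvfderiv IP (fun q => β q (W q)) p + mvfderiv IP (fun q => β q (W' q)) p := by
      rw [← mvfderiv_add (hd W hW) (hd W' hW')]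
      congr 1
      ext q
      simp
    unfold extDerivAux
    rw [h1, VectorField.mlieBracket_add_right hW hW']
    simp only [Pi.add_apply, map_add, add_apply]
    module

lemma tensorialAt_extDerivAux_left [FiniteDimensional ℝ EP]
    (β : (p : P) → TangentSpace IP p →L[ℝ] F)
    (hβ : ContMDiff IP.tangent 𝓘(ℝ, F) ∞ (fun v : TangentBundle IP P => β v.proj v.2)) (p : P)
    (W : (q : P) → TangentSpace IP q) :
    TensorialAt IP EP (fun V => extDerivAux β p V W) p := by
  have h := tensorialAt_extDerivAux β hβ p W
  simp only [extDerivAux_swap β p _ W]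
  exact ⟨fun hf hV => by rw [h.smul hf hV, smul_neg], fun hV hV' => by rw [h.add hV hV', neg_add]⟩

/-- The exterior derivative of a smooth vector-valued 1-form: the bilinear map with
`dβ(V, W) = V(β(W)) - W(β(V)) - β([V, W])` for all vector fields `V`, `W`. -/
def extDerivOneForm [FiniteDimensional ℝ EP] (β : (p : P) → TangentSpace IP p →L[ℝ] F)
    (hβ : ContMDiff IP.tangent 𝓘(ℝ, F) ∞ (fun v : TangentBundle IP P => β v.proj v.2)) (p : P) :
    TangentSpace IP p →L[ℝ] TangentSpace IP p →L[ℝ] F :=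
  TensorialAt.mkHom₂ (I := IP) (F := EP) (F' := EP) (extDerivAux β p) p
    (fun W _ => tensorialAt_extDerivAux_left β hβ p W)
    (fun V _ => tensorialAt_extDerivAux β hβ p V)

lemma extDerivOneForm_apply [FiniteDimensional ℝ EP] (β : (p : P) → TangentSpace IP p →L[ℝ] F)
    (hβ : ContMDiff IP.tangent 𝓘(ℝ, F) ∞ (fun v : TangentBundle IP P => β v.proj v.2)) (p : P)
    (V W : (q : P) → TangentSpace IP q)
    (hV : MDifferentiableAt IP IP.tangent (fun q => (⟨q, V q⟩ : TangentBundle IP P)) p)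
    (hW : MDifferentiableAt IP IP.tangent (fun q => (⟨q, W q⟩ : TangentBundle IP P)) p) :
    extDerivOneForm β hβ p (V p) (W p)
      = mvfderiv IP (fun q => β q (W q)) p (V p) - mvfderiv IP (fun q => β q (V q)) p (W p)
        - β p (VectorField.mlieBracket IP V W p) :=
  TensorialAt.mkHom₂_apply _ _ hV hW

end ExtDeriv

/-- The covariant exterior derivative `d_A α = π_A^* dα`. -/
def Connection.dA [FiniteDimensional ℝ EP] {B : PrincipalBundle IK K IP P IM M} (A : Connection B)
    (α : TensorialOneForm B) (p : P) (ζ ξ : TangentSpace IP p) : EK :=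
  extDerivOneForm α.form α.contMDiff p (A.horizontalProj p ζ) (A.horizontalProj p ξ)

/-! ### Levi-Civita connections -/

section LeviCivita

variable [IsManifold IM ∞ M]

/-- The connection `cov` on `TM` is compatible with the Riemannian metric `g`:
`u g(Y, Z) = g(∇_u Y, Z) + g(Y, ∇_u Z)`. -/
def IsMetricConnection
    (g : ContMDiffRiemannianMetric IM ∞ EM (TangentSpace IM : M → Type _))
    (cov : CovariantDerivative IM EM (TangentSpace IM : M → Type _)) : Prop :=
  ∀ (x : M) (u : TangentSpace IM x) (Y Z : (y : M) → TangentSpace IM y),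
    MDifferentiableAt IM IM.tangent (fun y => (⟨y, Y y⟩ : TangentBundle IM M)) x →
    MDifferentiableAt IM IM.tangent (fun y => (⟨y, Z y⟩ : TangentBundle IM M)) x →
    mvfderiv IM (fun y => g.inner y (Y y) (Z y)) x u
      = g.inner x (cov Y x u) (Z x) + g.inner x (Y x) (cov Z x u)

/-- `cov` is the Levi-Civita connection of `g`: it is the unique connection on `TM` that is
compatible with `g` and has vanishing torsion. -/
structure IsLeviCivita [FiniteDimensional ℝ EM]
    (g : ContMDiffRiemannianMetric IM ∞ EM (TangentSpace IM : M → Type _))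
    (cov : CovariantDerivative IM EM (TangentSpace IM : M → Type _)) : Prop where
  metric : IsMetricConnection g cov
  torsion_eq_zero : cov.torsion = 0
  unique : ∀ cov' : CovariantDerivative IM EM (TangentSpace IM : M → Type _),
    IsMetricConnection g cov' → cov'.torsion = 0 →
    ∀ (X : (y : M) → TangentSpace IM y) (x : M),
      MDifferentiableAt IM IM.tangent (fun y => (⟨y, X y⟩ : TangentBundle IM M)) x →
      cov' X x = cov X x

end LeviCivita

end PrincipalGeometry

end

noncomputable section

namespace PrincipalGeometry

/-! ### Smooth sections and forms on manifolds -/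

/-! Everything is computed on `P`. For `p` over `x` the map `u ↦ α_p(ũ)` identifies `T_xM` with the
fixed space `𝔨`, and a vector field `Z` on `M` becomes the function `f_Z = α(Z̃) : P → 𝔨`, where
`Z̃` is the horizontal lift (`wedge_veeEquiv`). In these terms `g_α(Y, Z) ∘ π = ⟨f_Y, f_Z⟩`
(`pullbackMetric_section`), and `∇_u Z` is the vector that corresponds to `df_Z(ũ)`
(`form_horizontalLift_pullbackNabla`).

Compatibility with the metric is then the product rule for the constant bilinear form `⟨·,·⟩`. For
the torsion, `Ỹ` and `Z̃` are `π`-related to `Y` and `Z`, so `[Ỹ, Z̃]` differs from the lift of `[Y,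
Z]` by a vertical vector, which `α` kills. Hence `α` of the lift of `T(Y, Z)` is `Ỹ(α(Z̃)) -
Z̃(α(Ỹ)) - α([Ỹ, Z̃]) = dα(Ỹ, Z̃)`: torsion and `d_Aα` are the same tensor under `∨α`
(`dA_eq_form_torsion`). The rest of the last claim is the classical uniqueness of a torsion-free
metric connection.

Smoothness rests on one principle (`contMDiffAt_of_form_apply`): a vector field is smooth if its
values under a smooth, fibrewise bijective vector-valued 1-form are. It is applied on `P` to `(π_*,
ω)` for horizontal lifts and to `(α, ω)` for `∇`; results descend to `M` along local sections of
`π`. -/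

lemma isVonNBounded_of_pos {E : Type*} [NormedAddCommGroup E] [NormedSpace ℝ E]
    [FiniteDimensional ℝ E] (b : E →L[ℝ] E →L[ℝ] ℝ) (hb : ∀ v, v ≠ 0 → 0 < b v v) :
    Bornology.IsVonNBounded ℝ {v : E | b v v < 1} := by
  rw [NormedSpace.isVonNBounded_iff, Metric.isBounded_iff_subset_closedBall 0]
  have hc : Continuous fun v : E => b v v := by fun_prop
  -- On a nonzero space the form has a minimum `m > 0` on the compact unit sphere, and `m‖v‖² ≤ b v
  -- v` by homogeneity. In the zero space the sphere is empty, hence the case split.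
  rcases subsingleton_or_nontrivial E with h | h
  · exact ⟨0, fun v _ => by simp [Subsingleton.elim v 0]⟩
  obtain ⟨v₀, hv₀, hmin⟩ := (isCompact_sphere (0 : E) 1).exists_isMinOn
    (NormedSpace.sphere_nonempty.2 zero_le_one) hc.continuousOn
  set m := b v₀ v₀
  have hm : 0 < m := hb v₀ (by rintro rfl; simp at hv₀)
  have hle : ∀ v : E, m * ‖v‖ ^ 2 ≤ b v v := by
    intro v
    rcases eq_or_ne v 0 with rfl | hv
    · simp
    have hv' : ‖v‖ ≠ 0 := norm_ne_zero_iff.2 hv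
    have h1 : m ≤ b (‖v‖⁻¹ • v) (‖v‖⁻¹ • v) := hmin (by simp [norm_smul, hv'])
    simp only [map_smul, smul_apply, smul_eq_mul] at h1
    calc m * ‖v‖ ^ 2 ≤ (‖v‖⁻¹ * (‖v‖⁻¹ * b v v)) * ‖v‖ ^ 2 := by gcongr
      _ = b v v := by field_simp
  refine ⟨Real.sqrt (1 / m), fun v hv => ?_⟩
  rw [mem_closedBall_zero_iff]
  apply Real.le_sqrt_of_sq_le
  rw [le_div_iff₀ hm, mul_comm]
  exact (hle v).trans hv.le

section Manifold

variable {E : Type*} [NormedAddCommGroup E] [NormedSpace ℝ E]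
  {H : Type*} [TopologicalSpace H] {I : ModelWithCorners ℝ E H}
  {N : Type*} [TopologicalSpace N] [ChartedSpace H N]
  {F : Type*} [NormedAddCommGroup F] [NormedSpace ℝ F]
  {G : Type*} [NormedAddCommGroup G] [NormedSpace ℝ G]
  {n : ℕ∞ω}

/-- In a basis of `F` an operator is the tuple of its values on the basis vectors, and smoothness
into a finite power of `G` is componentwise. -/
lemma contMDiffAt_clm_of_apply [FiniteDimensional ℝ F] {f : N → F →L[ℝ] G} {x : N}
    (h : ∀ y, ContMDiffAt I 𝓘(ℝ, G) n (fun z => f z y) x) :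
    ContMDiffAt I 𝓘(ℝ, F →L[ℝ] G) n f x := by
  let d := Module.finrank ℝ F
  have hd : d = Module.finrank ℝ (Fin d → ℝ) := (Module.finrank_fin_fun ℝ).symm
  let e₁ := ContinuousLinearEquiv.ofFinrankEq hd
  let e₂ := (e₁.arrowCongr (1 : G ≃L[ℝ] G)).trans (ContinuousLinearEquiv.piRing (Fin d))
  have h1 : ContMDiffAt I 𝓘(ℝ, Fin d → G) n (e₂ ∘ f) x :=
    contMDiffAt_pi_space.2 fun i => h _
  have h2 : f = e₂.symm ∘ (e₂ ∘ f) := by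
    ext z : 1
    exact (e₂.symm_apply_apply (f z)).symm
  rw [h2]
  exact e₂.symm.contDiff.contMDiff.contMDiffAt.comp x h1

/-- A section of a Hom-bundle is smooth at `x` if its values on the sections that are constant in a
trivialization around `x` are. -/
lemma contMDiffAt_hom_section [FiniteDimensional ℝ F]
    {V : N → Type*} [TopologicalSpace (TotalSpace F V)] [∀ x, AddCommGroup (V x)]
    [∀ x, Module ℝ (V x)] [∀ x, TopologicalSpace (V x)] [FiberBundle F V] [VectorBundle ℝ F V]
    {W : N → Type*} [TopologicalSpace (TotalSpace G W)] [∀ x, AddCommGroup (W x)]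
    [∀ x, Module ℝ (W x)] [∀ x, TopologicalSpace (W x)] [FiberBundle G W] [VectorBundle ℝ G W]
    [∀ x, IsTopologicalAddGroup (W x)] [∀ x, ContinuousSMul ℝ (W x)]
    (Φ : (x : N) → V x →L[ℝ] W x) (x : N)
    (h : ∀ b : F, ContMDiffAt I (I.prod 𝓘(ℝ, G)) n
      (fun y => TotalSpace.mk' G y (Φ y ((trivializationAt F V x).symm y b))) x) :
    ContMDiffAt I (I.prod 𝓘(ℝ, F →L[ℝ] G)) n
      (fun y => TotalSpace.mk' (F →L[ℝ] G) (E := fun x => V x →L[ℝ] W x) y (Φ y)) x := by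
  rw [contMDiffAt_hom_bundle]
  refine ⟨contMDiffAt_id, contMDiffAt_clm_of_apply fun b => ?_⟩
  have h1 := (contMDiffAt_section x).1 (h b)
  refine h1.congr_of_eventuallyEq ?_
  filter_upwards [(trivializationAt G W x).open_baseSet.mem_nhds
    (FiberBundle.mem_baseSet_trivializationAt G W x),
    (trivializationAt F V x).open_baseSet.mem_nhds
    (FiberBundle.mem_baseSet_trivializationAt F V x)] with y hy hy'
  simp only [ContinuousLinearMap.inCoordinates, ContinuousLinearMap.comp_apply]
  rw [Trivialization.continuousLinearMapAt_apply, Trivialization.linearMapAt_apply, if_pos hy,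
    Trivialization.symmL_apply _ hy']

lemma contMDiffAt_trivialization_symm [IsManifold I ∞ N] (x : N) (b : E) (hn : n ≤ ∞) :
    ContMDiffAt I I.tangent n
      (fun y => (⟨y, (trivializationAt E (TangentSpace I) x).symm y b⟩ : TangentBundle I N)) x := by
  have : ContMDiffAt I I.tangent ∞
      (fun y => (⟨y, (trivializationAt E (TangentSpace I) x).symm y b⟩ : TangentBundle I N)) x := by
    refine (contMDiffAt_section x).2 ?_
    refine (contMDiffAt_const (c := b)).congr_of_eventuallyEq ?_
    filter_upwards [(trivializationAt E (TangentSpace I) x).open_baseSet.mem_nhds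
      (FiberBundle.mem_baseSet_trivializationAt E (TangentSpace I) x)] with y hy
    rw [Trivialization.apply_mk_symm _ hy]
  exact this.of_le hn

variable {β : (q : N) → TangentSpace I q →L[ℝ] F}

/-- The inverse of a smooth vector-bundle map `TN → F` in a trivialization. -/
lemma exists_contMDiffAt_inverse [IsManifold I ∞ N] [FiniteDimensional ℝ E]
    [FiniteDimensional ℝ F] (hn : n ≤ ∞) {q₀ : N}
    (hβ : ∀ v : TangentSpace I q₀, ContMDiffAt I.tangent 𝓘(ℝ, F) n
      (fun v : TangentBundle I N => β v.proj v.2) ⟨q₀, v⟩)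
    (hbij : Bijective (β q₀)) :
    ∃ C : N → F →L[ℝ] E, ContMDiffAt I 𝓘(ℝ, F →L[ℝ] E) n C q₀ ∧
      ∀ᶠ q in 𝓝 q₀, ∀ v : TangentSpace I q,
        (trivializationAt E (TangentSpace I) q₀ ⟨q, v⟩).2 = C q (β q v) := by
  let e := trivializationAt E (TangentSpace I) q₀
  have hq₀ : q₀ ∈ e.baseSet := FiberBundle.mem_baseSet_trivializationAt E (TangentSpace I) q₀
  -- `D` is `β` read in the trivialization of the tangent bundle around `q₀`.
  let D : N → E →L[ℝ] F := fun q => (β q).comp (e.symmL ℝ q)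
  have hDapp (q : N) (hq : q ∈ e.baseSet) (b : E) : D q b = β q (e.symm q b) :=
    congrArg (β q) (Trivialization.symmL_apply e hq b)
  have hD : ContMDiffAt I 𝓘(ℝ, E →L[ℝ] F) n D q₀ := contMDiffAt_clm_of_apply fun b => by
    refine (ContMDiffAt.comp q₀ (hβ _)
      (contMDiffAt_trivialization_symm q₀ b hn)).congr_of_eventuallyEq ?_
    filter_upwards [e.open_baseSet.mem_nhds hq₀] with q hq using hDapp q hq b
  have hbij0 : Bijective (D q₀) := by
    have h := hbij.comp (e.continuousLinearEquivAt ℝ q₀ hq₀).symm.bijective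
    rwa [Trivialization.symm_continuousLinearEquivAt_eq] at h
  let L : E ≃L[ℝ] F := (LinearEquiv.ofBijective (D q₀).toLinearMap hbij0).toContinuousLinearEquiv
  have hL : (L : E →L[ℝ] F) = D q₀ := by ext; rfl
  -- `inverse` is a junk value at non-invertible operators, but the invertible ones form an open set
  -- on which inversion is smooth, and `D q₀` is invertible.
  refine ⟨fun q => (D q).inverse, ?_, ?_⟩
  · have h1 : ContDiffAt ℝ n ContinuousLinearMap.inverse (D q₀) := hL ▸ contDiffAt_map_inverse L
    exact h1.contMDiffAt.comp q₀ hD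
  · have h2 : ∀ᶠ q in 𝓝 q₀, D q ∈ range ((↑) : (E ≃L[ℝ] F) → E →L[ℝ] F) :=
      hD.continuousAt.eventually (hL ▸ L.nhds)
    filter_upwards [h2, e.open_baseSet.mem_nhds hq₀] with q ⟨Lq, hq⟩ hqe v
    have h3 : β q v = D q (e ⟨q, v⟩).2 := by
      rw [hDapp q hqe, Trivialization.symm_apply_apply_mk _ hqe]
    rw [h3, ← hq, ContinuousLinearMap.inverse_equiv]
    exact (Lq.symm_apply_apply _).symm

/-- Near `q₀` the coordinates of `X` are recovered from `β(X)` by a smooth family of operators. -/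
lemma contMDiffAt_of_form_apply [IsManifold I ∞ N] [FiniteDimensional ℝ E]
    [FiniteDimensional ℝ F] (hn : n ≤ ∞) {q₀ : N}
    (hβ : ∀ v : TangentSpace I q₀, ContMDiffAt I.tangent 𝓘(ℝ, F) n
      (fun v : TangentBundle I N => β v.proj v.2) ⟨q₀, v⟩)
    (hbij : Bijective (β q₀)) {X : (q : N) → TangentSpace I q}
    (hX : ContMDiffAt I 𝓘(ℝ, F) n (fun q => β q (X q)) q₀) :
    ContMDiffAt I I.tangent n (fun q => (⟨q, X q⟩ : TangentBundle I N)) q₀ := by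
  obtain ⟨C, hC, hC'⟩ := exists_contMDiffAt_inverse hn hβ hbij
  refine (contMDiffAt_section q₀).2 ((hC.clm_apply hX).congr_of_eventuallyEq ?_)
  filter_upwards [hC'] with q hq using hq _

/-- Needed alongside the smooth version because the Leibniz rule, metric compatibility and the
torsion formula concern fields that are only differentiable at a point. -/
lemma mdifferentiableAt_of_form_apply [IsManifold I ∞ N] [FiniteDimensional ℝ E]
    [FiniteDimensional ℝ F] {q₀ : N}
    (hβ : ∀ v : TangentSpace I q₀, ContMDiffAt I.tangent 𝓘(ℝ, F) ∞
      (fun v : TangentBundle I N => β v.proj v.2) ⟨q₀, v⟩)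
    (hbij : Bijective (β q₀)) {X : (q : N) → TangentSpace I q}
    (hX : MDifferentiableAt I 𝓘(ℝ, F) (fun q => β q (X q)) q₀) :
    MDifferentiableAt I I.tangent (fun q => (⟨q, X q⟩ : TangentBundle I N)) q₀ := by
  obtain ⟨C, hC, hC'⟩ := exists_contMDiffAt_inverse le_rfl hβ hbij
  refine (mdifferentiableAt_section _ _).2
    (((hC.mdifferentiableAt (by simp)).clm_apply hX).congr_of_eventuallyEq ?_)
  filter_upwards [hC'] with q hq using hq _

lemma contMDiffAt_mvfderiv_apply [IsManifold I 1 N] {f : N → F} {q₀ : N} {m : ℕ∞ω}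
    {X : (q : N) → TangentSpace I q} (hf : ContMDiffAt I 𝓘(ℝ, F) n f q₀)
    (hX : ContMDiffAt I I.tangent m (fun q => (⟨q, X q⟩ : TangentBundle I N)) q₀)
    (hmn : m + 1 ≤ n) :
    ContMDiffAt I 𝓘(ℝ, F) m (fun q => mvfderiv I f q (X q)) q₀ := by
  have h1 : ContMDiffAt I 𝓘(ℝ, F).tangent m
      (fun q => (⟨f q, mfderiv I 𝓘(ℝ, F) f q (X q)⟩ : TangentBundle 𝓘(ℝ, F) F)) q₀ :=
    ContMDiffAt.clm_apply_of_inCoordinates (hf.mfderiv_const hmn) hX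
      (hf.of_le (le_self_add.trans hmn))
  exact (contMDiff_snd_tangentBundle_modelSpace F 𝓘(ℝ, F)).contMDiffAt.comp q₀ h1

lemma mdifferentiableAt_mvfderiv_apply [IsManifold I 1 N] {f : N → F} {q₀ : N}
    {X : (q : N) → TangentSpace I q} (hf : ContMDiffAt I 𝓘(ℝ, F) 2 f q₀)
    (hX : MDifferentiableAt I I.tangent (fun q => (⟨q, X q⟩ : TangentBundle I N)) q₀) :
    MDifferentiableAt I 𝓘(ℝ, F) (fun q => mvfderiv I f q (X q)) q₀ := by
  have h0 := hf.mfderiv_const (m := 1) (by norm_num [one_add_one_eq_two])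
  have h1 : MDifferentiableAt I 𝓘(ℝ, F).tangent
      (fun q => (⟨f q, mfderiv I 𝓘(ℝ, F) f q (X q)⟩ : TangentBundle 𝓘(ℝ, F) F)) q₀ :=
    MDifferentiableAt.clm_apply_of_inCoordinates (h0.mdifferentiableAt (by simp)) hX
      (hf.mdifferentiableAt (by simp))
  exact ((contMDiff_snd_tangentBundle_modelSpace F 𝓘(ℝ, F)).mdifferentiable
    (n := 1) (by simp) _).comp q₀ h1

lemma mvfderiv_bilinear (b : F →L[ℝ] F →L[ℝ] G) {f g : N → F} {p : N}
    (hf : MDifferentiableAt I 𝓘(ℝ, F) f p) (hg : MDifferentiableAt I 𝓘(ℝ, F) g p)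
    (w : TangentSpace I p) :
    mvfderiv I (fun q => b (f q) (g q)) p w
      = b (mvfderiv I f p w) (g p) + b (f p) (mvfderiv I g p w) := by
  have hb : HasFDerivAt (fun z : F × F => b z.1 z.2) (b.deriv₂ (f p, g p)) (f p, g p) :=
    b.isBoundedBilinearMap.hasFDerivAt _
  have h1 : HasMFDerivAt I 𝓘(ℝ, F × F) (fun q => (f q, g q)) p
      ((mvfderiv I f p).prod (mvfderiv I g p)) :=
    ⟨hf.hasMFDerivAt.1.prodMk hg.hasMFDerivAt.1, hf.hasMFDerivAt.2.prodMk hg.hasMFDerivAt.2⟩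
  have h2 := HasMFDerivAt.comp (I' := 𝓘(ℝ, F × F)) p hb.hasMFDerivAt h1
  exact (congrArg (fun L : E →L[ℝ] G => L w) h2.mfderiv).trans (add_comm _ _)

end Manifold

/-! ### Lie brackets of related vector fields -/

section Bracket

variable {E : Type*} [NormedAddCommGroup E] [NormedSpace ℝ E]
  {H : Type*} [TopologicalSpace H] {I : ModelWithCorners ℝ E H}
  {N : Type*} [TopologicalSpace N] [ChartedSpace H N]
  {F : Type*} [NormedAddCommGroup F] [NormedSpace ℝ F]

/-- The derivative of `f'(W)` along `V` is `f''(V, W) + f'(W'V)`. As `f''` is symmetric, it cancels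
in the commutator, leaving `f'(W'V - V'W)`. -/
lemma fderiv_lieBracket {f : E → F} {V W : E → E} {y : E} (hf : ContDiffAt ℝ 2 f y)
    (hV : DifferentiableAt ℝ V y) (hW : DifferentiableAt ℝ W y) :
    fderiv ℝ f y (VectorField.lieBracket ℝ V W y)
      = fderiv ℝ (fun z => fderiv ℝ f z (W z)) y (V y)
        - fderiv ℝ (fun z => fderiv ℝ f z (V z)) y (W y) := by
  have h1 : DifferentiableAt ℝ (fderiv ℝ f) y :=
    (hf.fderiv_right (m := 1) (by norm_num [one_add_one_eq_two])).differentiableAt (by simp)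
  have h2 := (hf.isSymmSndFDerivAt (by simp [minSmoothness_of_isRCLikeNormedField])) (V y) (W y)
  rw [fderiv_clm_apply h1 hW, fderiv_clm_apply h1 hV, VectorField.lieBracket_eq]
  simp only [map_sub, add_apply, ContinuousLinearMap.comp_apply, ContinuousLinearMap.flip_apply]
  rw [h2]
  abel

variable [I.Boundaryless] [IsManifold I 2 N]

/-- The Lie bracket acts on functions as the commutator of derivations. -/
lemma mvfderiv_mlieBracket [CompleteSpace E] {f : N → F} {V W : (q : N) → TangentSpace I q} {p : N}
    (hf : ContMDiffAt I 𝓘(ℝ, F) 2 f p)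
    (hV : MDifferentiableAt I I.tangent (fun q => (⟨q, V q⟩ : TangentBundle I N)) p)
    (hW : MDifferentiableAt I I.tangent (fun q => (⟨q, W q⟩ : TangentBundle I N)) p) :
    mvfderiv I f p (VectorField.mlieBracket I V W p)
      = mvfderiv I (fun q => mvfderiv I f q (W q)) p (V p)
        - mvfderiv I (fun q => mvfderiv I f q (V q)) p (W p) := by
  set ψ := extChartAt I p with hψ
  let f' : E → F := f ∘ ψ.symm
  let pb (X : (q : N) → TangentSpace I q) : E → E :=
    VectorField.mpullbackWithin 𝓘(ℝ, E) I ψ.symm X (range I)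
  have hsrc : ψ.source ∈ 𝓝 p := extChartAt_source_mem_nhds p
  -- The pull-back along `ψ.symm` uses the inverse of the derivative of `ψ.symm`, which is the
  -- derivative of `ψ`: so `pb X` is the field `X` read in the chart.
  have hpb (X : (q : N) → TangentSpace I q) {q : N} (hq : q ∈ ψ.source) :
      pb X (ψ q) = (mfderiv I 𝓘(ℝ, E) ψ q : E →L[ℝ] E) (X q) := by
    have hy : ψ q ∈ ψ.target := ψ.map_source hq
    have h1 : pb X (ψ q) = (mfderiv I 𝓘(ℝ, E) ψ (ψ.symm (ψ q)) : E →L[ℝ] E)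
        (X (ψ.symm (ψ q))) := by
      obtain ⟨A, hA⟩ := isInvertible_mfderivWithin_extChartAt_symm (I := I) hy
      have h2 := mfderiv_extChartAt_comp_mfderivWithin_extChartAt_symm (I := I) hy
      have h3 : pb X (ψ q) = A.symm (X (ψ.symm (ψ q))) := by
        change (mfderivWithin 𝓘(ℝ, E) I ψ.symm (range I) (ψ q)).inverse _ = _
        rw [← hA, ContinuousLinearMap.inverse_equiv]
        rfl
      rw [← hA] at h2
      have h4 := congrArg (fun L : E →L[ℝ] E => L (A.symm (X (ψ.symm (ψ q))))) h2
      rw [h3]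
      refine h4.symm.trans ?_
      exact congrArg (mfderiv I 𝓘(ℝ, E) ψ (ψ.symm (ψ q)) : E →L[ℝ] E) (A.apply_symm_apply _)
    have h2 : ∀ r, r = q → (mfderiv I 𝓘(ℝ, E) ψ r : E →L[ℝ] E) (X r)
        = (mfderiv I 𝓘(ℝ, E) ψ q : E →L[ℝ] E) (X q) := by rintro _ rfl; rfl
    rw [h1, h2 _ (ψ.left_inv hq)]
  have hpbd (X : (q : N) → TangentSpace I q)
      (hX : MDifferentiableAt I I.tangent (fun q => (⟨q, X q⟩ : TangentBundle I N)) p) :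
      DifferentiableAt ℝ (pb X) (ψ p) := by
    have := (hX.mdifferentiableWithinAt (s := univ)
      ).differentiableWithinAt_mpullbackWithin_vectorField
    exact this.differentiableAt (by simp [I.range_eq_univ])
  have hf' : ContDiffAt ℝ 2 f' (ψ p) := by
    have := (contMDiffAt_iff.1 hf).2
    rw [I.range_eq_univ, contDiffWithinAt_univ] at this
    exact this
  have hchain {g : E → F} {h : N → F} {q : N} (hq : q ∈ ψ.source) (hg : DifferentiableAt ℝ g (ψ q))
      (hgh : ∀ᶠ z in 𝓝 q, h z = g (ψ z)) (u : TangentSpace I q) :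
      mvfderiv I h q u = fderiv ℝ g (ψ q) ((mfderiv I 𝓘(ℝ, E) ψ q : E →L[ℝ] E) u) := by
    have h1 : HasMFDerivAt I 𝓘(ℝ, E) ψ q (mfderiv I 𝓘(ℝ, E) ψ q) :=
      (mdifferentiableAt_extChartAt (by simpa [hψ] using hq)).hasMFDerivAt
    have h2 := (hg.hasFDerivAt.hasMFDerivAt.comp q h1).congr_of_eventuallyEq hgh
    exact congrArg (fun L : E →L[ℝ] F => L u) h2.mfderiv
  have hff : ∀ q ∈ ψ.source, ∀ᶠ z in 𝓝 q, f z = f' (ψ z) := by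
    intro q hq
    filter_upwards [(isOpen_extChartAt_source p).mem_nhds hq] with z hz
    simp [f', ψ.left_inv hz]
  have hdf (X : (q : N) → TangentSpace I q) :
      ∀ᶠ z in 𝓝 p, mvfderiv I f z (X z) = fderiv ℝ f' (ψ z) (pb X (ψ z)) := by
    have h1 : ∀ᶠ y in 𝓝 (ψ p), DifferentiableAt ℝ f' y := by
      filter_upwards [hf'.eventually (by simp)] with y hy using hy.differentiableAt (by simp)
    filter_upwards [hsrc, (continuousAt_extChartAt p).eventually h1] with z hz hz'
    rw [hpb X hz, hchain hz hz' (hff z hz)]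
  have h1 : DifferentiableAt ℝ (fderiv ℝ f') (ψ p) :=
    (hf'.fderiv_right (m := 1) (by norm_num [one_add_one_eq_two])).differentiableAt (by simp)
  have hp : p ∈ ψ.source := mem_extChartAt_source p
  -- The bracket on `N` is by definition the bracket of the chart representatives, transported back
  -- by the inverse of the derivative of `ψ`.
  have hbr : (mfderiv I 𝓘(ℝ, E) ψ p : E →L[ℝ] E) (VectorField.mlieBracket I V W p)
      = VectorField.lieBracket ℝ (pb V) (pb W) (ψ p) := by
    obtain ⟨A, hA⟩ := isInvertible_mfderiv_extChartAt (I := I) hp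
    let L : E := VectorField.lieBracket ℝ (pb V) (pb W) (ψ p)
    have hL : VectorField.lieBracketWithin ℝ (pb V) (pb W) (range I) (ψ p) = L := by
      rw [I.range_eq_univ, VectorField.lieBracketWithin_univ]
    have h2 : VectorField.mlieBracket I V W p = A.symm L := by
      rw [← VectorField.mlieBracketWithin_univ, VectorField.mlieBracketWithin_apply, ← hA,
        ContinuousLinearMap.inverse_equiv, preimage_univ, univ_inter]
      exact congrArg A.symm hL
    rw [h2]
    refine (congrArg (fun T : E →L[ℝ] E => T (A.symm L)) hA.symm).trans ?_
    exact A.apply_symm_apply _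
  rw [hchain hp (h1.clm_apply (hpbd W hW)) (hdf W), hchain hp (h1.clm_apply (hpbd V hV)) (hdf V),
    ← hpb V hp, ← hpb W hp, ← fderiv_lieBracket hf' (hpbd V hV) (hpbd W hW),
    hchain hp (hf'.differentiableAt (by simp)) (hff p hp), hbr]

variable {E' : Type*} [NormedAddCommGroup E'] [NormedSpace ℝ E']
  {H' : Type*} [TopologicalSpace H'] {I' : ModelWithCorners ℝ E' H'} [I'.Boundaryless]
  {N' : Type*} [TopologicalSpace N'] [ChartedSpace H' N'] [IsManifold I' 2 N']

/-- Brackets of `ρ`-related vector fields are `ρ`-related. -/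
lemma mfderiv_mlieBracket_of_related [CompleteSpace E] [CompleteSpace E'] {ρ : N → N'}
    (hρ : ContMDiff I I' 2 ρ)
    {V W : (q : N) → TangentSpace I q} {V' W' : (q : N') → TangentSpace I' q} {p : N}
    (hVV' : ∀ q, mfderiv I I' ρ q (V q) = V' (ρ q))
    (hWW' : ∀ q, mfderiv I I' ρ q (W q) = W' (ρ q))
    (hV : MDifferentiableAt I I.tangent (fun q => (⟨q, V q⟩ : TangentBundle I N)) p)
    (hW : MDifferentiableAt I I.tangent (fun q => (⟨q, W q⟩ : TangentBundle I N)) p)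
    (hV' : MDifferentiableAt I' I'.tangent (fun q => (⟨q, V' q⟩ : TangentBundle I' N')) (ρ p))
    (hW' : MDifferentiableAt I' I'.tangent (fun q => (⟨q, W' q⟩ : TangentBundle I' N')) (ρ p)) :
    mfderiv I I' ρ p (VectorField.mlieBracket I V W p)
      = VectorField.mlieBracket I' V' W' (ρ p) := by
  -- The chart serves as a vector-valued test function: its derivative at `ρ p` is invertible, so
  -- two tangent vectors there agree once they differentiate `χ` alike.
  let χ : N' → E' := extChartAt I' (ρ p)
  have hχ : ContMDiffAt I' 𝓘(ℝ, E') 2 χ (ρ p) := contMDiffAt_extChartAt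
  have hρd : MDifferentiable I I' ρ := hρ.mdifferentiable (by simp)
  have hsrc : ∀ᶠ q in 𝓝 p, MDifferentiableAt I' 𝓘(ℝ, E') χ (ρ q) := by
    filter_upwards [(hρ.continuous.continuousAt (x := p)).eventually
      ((isOpen_extChartAt_source (I := I') (ρ p)).mem_nhds (mem_extChartAt_source _))] with q hq
    exact mdifferentiableAt_extChartAt (by rwa [← extChartAt_source I'])
  have hcomp {h : N' → E'} {q : N} (hh : MDifferentiableAt I' 𝓘(ℝ, E') h (ρ q))
      (u : TangentSpace I q) :
      mvfderiv I (h ∘ ρ) q u = mvfderiv I' h (ρ q) (mfderiv I I' ρ q u) :=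
    congrArg (fun L : E →L[ℝ] E' => L u) (mfderiv_comp q hh (hρd q))
  have hrel {X : (q : N) → TangentSpace I q} {X' : (q : N') → TangentSpace I' q}
      (hXX' : ∀ q, mfderiv I I' ρ q (X q) = X' (ρ q)) {Y : (q : N) → TangentSpace I q}
      {Y' : (q : N') → TangentSpace I' q} (hYY' : ∀ q, mfderiv I I' ρ q (Y q) = Y' (ρ q))
      (hX' : MDifferentiableAt I' I'.tangent (fun q => (⟨q, X' q⟩ : TangentBundle I' N')) (ρ p)) :
      mvfderiv I (fun q => mvfderiv I (χ ∘ ρ) q (X q)) p (Y p)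
        = mvfderiv I' (fun y => mvfderiv I' χ y (X' y)) (ρ p) (Y' (ρ p)) := by
    rw [← hYY', ← hcomp (mdifferentiableAt_mvfderiv_apply hχ hX')]
    refine congrArg (fun L : E →L[ℝ] E' => L (Y p)) (Filter.EventuallyEq.mfderiv_eq ?_)
    filter_upwards [hsrc] with q hq
    rw [hcomp hq, hXX']
    rfl
  -- The commutator formula for `χ ∘ ρ` on `N` turns, by relatedness, into the commutator formula
  -- for `χ` on `N'`.
  have h1 := mvfderiv_mlieBracket (hχ.comp p (hρ p)) hV hW
  rw [hcomp hsrc.self_of_nhds, hrel hWW' hVV' hW', hrel hVV' hWW' hV',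
    ← mvfderiv_mlieBracket hχ hV' hW'] at h1
  obtain ⟨A, hA⟩ := isInvertible_mfderiv_extChartAt (I := I') (mem_extChartAt_source (ρ p))
  apply A.injective
  have h2 : ∀ u, mvfderiv I' χ (ρ p) u = A u := fun u =>
    (congrArg (fun T : E' →L[ℝ] E' => T u) hA).symm
  exact (h2 _).symm.trans (h1.trans (h2 _))

end Bracket

section LeviCivita

variable
  {EM : Type*} [NormedAddCommGroup EM] [NormedSpace ℝ EM] [FiniteDimensional ℝ EM]
  {HM : Type*} [TopologicalSpace HM] {IM : ModelWithCorners ℝ EM HM}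
  {M : Type*} [TopologicalSpace M] [ChartedSpace HM M] [IsManifold IM ∞ M]

/-! ### Uniqueness of the Levi-Civita connection -/

/-- The difference `D` of two such connections is a tensor. Vanishing torsion makes it symmetric,
compatibility makes each `v ↦ D v u` skew for `g`, and both together force `D = 0`. -/
lemma isLeviCivita_of_metric_of_torsion_eq_zero
    {g : ContMDiffRiemannianMetric IM ∞ EM (TangentSpace IM : M → Type _)}
    {cov : CovariantDerivative IM EM (TangentSpace IM : M → Type _)}
    (hcov : IsMetricConnection g cov) (htor : cov.torsion = 0) : IsLeviCivita g cov := by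
  refine ⟨hcov, htor, fun cov' hcov' htor' X x hX => ?_⟩
  let V := TangentSpace IM x
  have hext (u : V) : ∃ Y : (x : M) → TangentSpace IM x, Y x = u ∧
      MDifferentiableAt IM IM.tangent (fun y => (⟨y, Y y⟩ : TangentBundle IM M)) x :=
    ⟨FiberBundle.extend EM u, FiberBundle.extend_apply_self .., FiberBundle.mdifferentiableAt_extend ..⟩
  let D := cov'.difference cov x
  have hD {Y : (x : M) → TangentSpace IM x}
      (hY : MDifferentiableAt IM IM.tangent (fun y => (⟨y, Y y⟩ : TangentBundle IM M)) x)
      (u : V) : D (Y x) u = cov' Y x u - cov Y x u := by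
    have := IsCovariantDerivativeOn.difference_apply cov'.isCovariantDerivativeOnUniv
      cov.isCovariantDerivativeOnUniv (x := x) (mem_univ x) hY
    exact congrArg (fun L : EM →L[ℝ] EM => L u) this
  have hsymm (u v : V) : D u v = D v u := by
    obtain ⟨Y, rfl, hY⟩ := hext u
    obtain ⟨Z, rfl, hZ⟩ := hext v
    have h1 := CovariantDerivative.torsion_eq_zero_iff cov |>.1 htor hY hZ
    have h2 := CovariantDerivative.torsion_eq_zero_iff cov' |>.1 htor' hY hZ
    rw [hD hY, hD hZ, sub_eq_sub_iff_sub_eq_sub]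
    rw [← neg_inj, neg_sub, neg_sub, h1, h2]
  have hskew (u v w : V) : g.inner x (D v u) w = - g.inner x (D w u) v := by
    obtain ⟨Y, rfl, hY⟩ := hext v
    obtain ⟨Z, rfl, hZ⟩ := hext w
    have h1 := hcov x u Y Z hY hZ
    have h2 := hcov' x u Y Z hY hZ
    rw [hD hY, hD hZ, g.symm x _ (Y x)]
    simp only [map_sub, sub_apply]
    linarith
  have hzero (u v : V) : D u v = 0 := by
    by_contra hne
    have hpos := g.pos x _ hne
    -- The trilinear form `T(u, v, w) = g(D u v, w)` is unchanged when its first two arguments are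
    -- swapped and changes sign when the first and third are. These transpositions are conjugate in
    -- the symmetric group, so `T = -T`.
    have h (w : V) : g.inner x (D u v) w = 0 := by
      have e1 := hskew v u w
      have e2 := hskew w v u
      have e3 := hskew u w v
      rw [hsymm w v] at e1
      rw [hsymm u w] at e2
      rw [hsymm v u] at e3
      linarith
    exact hpos.ne' (h _)
  ext u
  have := hD hX u
  rw [hzero] at this
  exact (sub_eq_zero.1 this.symm)

end LeviCivita

/-! ### Local sections of the bundle and horizontal lifts of vector fields -/

section Principal

variable
  {EK : Type*} [NormedAddCommGroup EK] [NormedSpace ℝ EK]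
  {HK : Type*} [TopologicalSpace HK] {IK : ModelWithCorners ℝ EK HK}
  {K : Type*} [TopologicalSpace K] [ChartedSpace HK K] [Group K] [LieGroup IK ∞ K]
  {EP : Type*} [NormedAddCommGroup EP] [NormedSpace ℝ EP]
  {HP : Type*} [TopologicalSpace HP] {IP : ModelWithCorners ℝ EP HP}
  {P : Type*} [TopologicalSpace P] [ChartedSpace HP P] [IsManifold IP ∞ P]
  {EM : Type*} [NormedAddCommGroup EM] [NormedSpace ℝ EM]
  {HM : Type*} [TopologicalSpace HM] {IM : ModelWithCorners ℝ EM HM}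
  {M : Type*} [TopologicalSpace M] [ChartedSpace HM M]
  {B : PrincipalBundle IK K IP P IM M}

/-- The section with constant `K`-component in a local trivialization. It carries smoothness from
`P` down to `M`. -/
lemma exists_contMDiffAt_section (B : PrincipalBundle IK K IP P IM M) (p : P) :
    ∃ s : M → P, ContMDiffAt IM IP ∞ s (B.proj p) ∧ s (B.proj p) = p ∧
      ∀ᶠ y in 𝓝 (B.proj p), B.proj (s y) = y := by
  obtain ⟨e, hx, -, hes, -⟩ := B.exists_trivialization (B.proj p)
  have hp : p ∈ e.source := by rwa [e.mem_source]
  refine ⟨fun y => e.toOpenPartialHomeomorph.symm (y, (e p).2), ?_, ?_, ?_⟩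
  · exact (hes.contMDiffAt (e.open_target.mem_nhds (e.mem_target.2 hx))).comp (B.proj p)
      (contMDiffAt_id.prodMk contMDiffAt_const)
  · have hep : (B.proj p, (e p).2) = e p := Prod.ext (e.coe_fst hp).symm rfl
    simp only [hep]
    exact e.toOpenPartialHomeomorph.left_inv hp
  · filter_upwards [e.open_baseSet.mem_nhds hx] with y hy using e.proj_symm_apply' hy

namespace Connection

variable (A : Connection B)

/-- The horizontal lift of a vector field on `M` to `P`. -/
def liftField (Z : (x : M) → TangentSpace IM x) (p : P) : TangentSpace IP p :=
  A.horizontalLift (⟨p, rfl⟩ : B.Fiber (B.proj p)) (Z (B.proj p))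

lemma form_liftField (Z : (x : M) → TangentSpace IM x) (p : P) :
    A.form p (A.liftField Z p) = 0 :=
  A.form_horizontalLift (⟨p, rfl⟩ : B.Fiber (B.proj p)) _

lemma mfderiv_proj_liftField (Z : (x : M) → TangentSpace IM x) (p : P) :
    mfderiv IP IM B.proj p (A.liftField Z p) = Z (B.proj p) :=
  A.dproj_horizontalLift (⟨p, rfl⟩ : B.Fiber (B.proj p)) _

lemma liftField_eq (Z : (x : M) → TangentSpace IM x) {x : M} (p : B.Fiber x) :
    A.liftField Z p.1 = A.horizontalLift p (Z x) := by
  obtain ⟨p, rfl⟩ := p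
  rfl

/-- Both sides are horizontal and have the same projection to `M`. Thus `d_Aα` depends only on the
projections of its arguments. -/
lemma horizontalProj_eq (p : P) (ζ : TangentSpace IP p) :
    A.horizontalProj p ζ
      = A.horizontalLift (⟨p, rfl⟩ : B.Fiber (B.proj p)) (mfderiv IP IM B.proj p ζ) := by
  let p' : B.Fiber (B.proj p) := ⟨p, rfl⟩
  refine A.eq_of_dproj_eq p' (A.horizontalProj_mem p ζ) (A.form_horizontalLift p' _) ?_
  refine Eq.trans ?_ (A.dproj_horizontalLift p' _).symm
  change B.dproj p' (ζ - B.fundamental p (A.form p ζ)) = _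
  rw [map_sub, B.dproj_fundamental p', sub_zero]
  rfl

section Lift

variable [IsManifold IM ∞ M]

/-- The differential of the projection, read in a trivialization of `TM` around `x`, together with
the connection form. -/
def projForm (x : M) (q : P) : TangentSpace IP q →L[ℝ] EM × EK :=
  ((((trivializationAt EM (TangentSpace IM) x).continuousLinearMapAt ℝ (B.proj q)).comp
    (mfderiv IP IM B.proj q : TangentSpace IP q →L[ℝ] TangentSpace IM (B.proj q))).prod (A.form q))

/-- Only over the base set: elsewhere `continuousLinearMapAt` takes its default value `0`. -/
lemma projForm_apply {x : M} {q : P}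
    (hq : B.proj q ∈ (trivializationAt EM (TangentSpace IM) x).baseSet) (v : TangentSpace IP q) :
    A.projForm x q v = ((trivializationAt EM (TangentSpace IM) x
      ⟨B.proj q, mfderiv IP IM B.proj q v⟩).2, A.form q v) := by
  refine Prod.ext ?_ rfl
  exact Trivialization.continuousLinearMapAt_apply_of_mem ℝ _ hq _

lemma contMDiffAt_projForm (p : P) (v : TangentSpace IP p) :
    ContMDiffAt IP.tangent 𝓘(ℝ, EM × EK) ∞
      (fun v : TangentBundle IP P => A.projForm (B.proj p) v.proj v.2) ⟨p, v⟩ := by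
  have h1 : ContMDiffAt IP.tangent IM.tangent ∞ (tangentMap IP IM B.proj) ⟨p, v⟩ :=
    B.contMDiff_proj.contMDiff_tangentMap (by simp) _
  have h2 := ((contMDiffAt_totalSpace.1 h1).2).prodMk_space (A.contMDiff ⟨p, v⟩)
  refine h2.congr_of_eventuallyEq ?_
  have h3 : ContinuousAt (fun v : TangentBundle IP P => B.proj v.proj) ⟨p, v⟩ :=
    B.contMDiff_proj.continuous.continuousAt.comp
      (FiberBundle.continuous_proj EP (TangentSpace IP)).continuousAt
  filter_upwards [h3.eventually ((trivializationAt EM (TangentSpace IM) (B.proj p)).open_baseSet.mem_nhds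
    (FiberBundle.mem_baseSet_trivializationAt EM (TangentSpace IM) (B.proj p)))] with w hw
  exact A.projForm_apply hw w.2

/-- `T_pP` splits into horizontal and vertical vectors: `π_*` is an isomorphism on the former and
kills the latter, and the connection form does the reverse. -/
lemma bijective_projForm (p : P) : Bijective (A.projForm (B.proj p) p) := by
  let e := trivializationAt EM (TangentSpace IM) (B.proj p)
  have he : B.proj p ∈ e.baseSet := FiberBundle.mem_baseSet_trivializationAt EM _ _
  let L := e.continuousLinearEquivAt ℝ (B.proj p) he
  let p' : B.Fiber (B.proj p) := ⟨p, rfl⟩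
  have happ (v : TangentSpace IP p) : A.projForm (B.proj p) p v = (L (B.dproj p' v), A.form p v) :=
    A.projForm_apply he v
  constructor
  · rw [injective_iff_map_eq_zero]
    intro v hv
    rw [happ] at hv
    have h1 : B.dproj p' v = 0 := L.injective ((congrArg Prod.fst hv).trans (map_zero L).symm)
    exact A.eq_of_dproj_eq p' (congrArg Prod.snd hv) (map_zero _) (h1.trans (map_zero _).symm)
  · rintro ⟨b, X⟩
    refine ⟨A.horizontalLift p' (L.symm b) + B.fundamental p X, ?_⟩
    rw [happ]
    refine Prod.ext ?_ ?_
    · change L (B.dproj p' _) = b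
      rw [map_add, dproj_horizontalLift, B.dproj_fundamental p', add_zero, L.apply_symm_apply]
    · change A.form p _ = X
      rw [map_add, A.form_horizontalLift p', A.form_fundamental, zero_add]

/-- The values of the lift under `projForm` are the coordinates of `Z` and `0`, so the lift is as
regular as `Z`. -/
lemma eventually_projForm_liftField (Z : (x : M) → TangentSpace IM x) (p : P) :
    ∀ᶠ q in 𝓝 p, A.projForm (B.proj p) q (A.liftField Z q)
      = ((trivializationAt EM (TangentSpace IM) (B.proj p) ⟨B.proj q, Z (B.proj q)⟩).2, 0) := by
  filter_upwards [(B.contMDiff_proj.continuous.continuousAt (x := p)).eventually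
    ((trivializationAt EM (TangentSpace IM) (B.proj p)).open_baseSet.mem_nhds
    (FiberBundle.mem_baseSet_trivializationAt EM (TangentSpace IM) (B.proj p)))] with q hq
  rw [A.projForm_apply hq, mfderiv_proj_liftField, form_liftField]

variable [FiniteDimensional ℝ EK] [FiniteDimensional ℝ EP] [FiniteDimensional ℝ EM]

lemma contMDiffAt_liftField {Z : (x : M) → TangentSpace IM x} {p : P}
    (hZ : ContMDiffAt IM IM.tangent ∞ (fun y => (⟨y, Z y⟩ : TangentBundle IM M)) (B.proj p)) :
    ContMDiffAt IP IP.tangent ∞ (fun q => (⟨q, A.liftField Z q⟩ : TangentBundle IP P)) p := by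
  refine contMDiffAt_of_form_apply le_rfl (A.contMDiffAt_projForm p) (A.bijective_projForm p) ?_
  refine ContMDiffAt.congr_of_eventuallyEq ?_ (A.eventually_projForm_liftField Z p)
  exact (((contMDiffAt_section _).1 hZ).comp p (B.contMDiff_proj p)).prodMk_space contMDiffAt_const

lemma mdifferentiableAt_liftField {Z : (x : M) → TangentSpace IM x} {p : P}
    (hZ : MDifferentiableAt IM IM.tangent (fun y => (⟨y, Z y⟩ : TangentBundle IM M)) (B.proj p)) :
    MDifferentiableAt IP IP.tangent (fun q => (⟨q, A.liftField Z q⟩ : TangentBundle IP P)) p := by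
  refine mdifferentiableAt_of_form_apply (A.contMDiffAt_projForm p) (A.bijective_projForm p) ?_
  refine MDifferentiableAt.congr_of_eventuallyEq ?_ (A.eventually_projForm_liftField Z p)
  exact (((mdifferentiableAt_section _ _).1 hZ).comp p (B.mdifferentiable_proj p)).prodMk_space
    mdifferentiableAt_const

end Lift

/-! ### The function `∧(∨α(Z))` on `P` -/

variable {A} {α : TensorialOneForm B} (hα : A.IsIsoOnHorizontal α)

/-- The dictionary between `M` and `P`: a vector field becomes a `𝔨`-valued function, on which `∇^A`
acts by differentiation along horizontal lifts. -/
lemma wedge_veeEquiv (Z : (x : M) → TangentSpace IM x) :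
    wedge (fun y => veeEquiv hα y (Z y)) = fun q => α.form q (A.liftField Z q) := by
  ext q
  unfold wedge
  rw [LinearEquiv.symm_apply_eq, B.adMkₗ_apply]
  exact veeEquiv_apply A hα (⟨q, rfl⟩ : B.Fiber (B.proj q)) _

lemma IsIsoOnHorizontal.bijective_comp_horizontalLift (hα : A.IsIsoOnHorizontal α) {x : M} (p : B.Fiber x) :
    Bijective (fun u => α.form p.1 (A.horizontalLift p u)) :=
  (hα p.1).comp (A.dprojEquiv p).symm.bijective

/-- Since `u ↦ α_p(ũ)` is injective, this characterizes `∇`; each property of `∇` below is read off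
from it. -/
lemma form_horizontalLift_pullbackNabla (X : (x : M) → TangentSpace IM x) {x : M} (p : B.Fiber x)
    (u : TangentSpace IM x) :
    α.form p.1 (A.horizontalLift p (pullbackNabla hα X x u))
      = mvfderiv IP (fun q => α.form q (A.liftField X q)) p.1 (A.horizontalLift p u) := by
  apply (B.adMk_bijective p).1
  rw [← wedge_veeEquiv hα, ← nablaAd_apply, ← veeEquiv_apply A hα]
  exact (veeEquiv hα x).apply_symm_apply _

lemma pullbackMetric_eq (κ : AdInvariantInner IK K) {x : M} (p : B.Fiber x)
    (u v : TangentSpace IM x) :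
    pullbackMetric hα κ x u v
      = κ.form (α.form p.1 (A.horizontalLift p u)) (α.form p.1 (A.horizontalLift p v)) := by
  unfold pullbackMetric
  rw [veeEquiv_apply A hα p, veeEquiv_apply A hα p, B.adMetric_adMk]

lemma pullbackMetric_pos (κ : AdInvariantInner IK K) {x : M} (v : TangentSpace IM x) (hv : v ≠ 0) :
    0 < pullbackMetric hα κ x v v := by
  rw [pullbackMetric_eq hα κ (B.basePoint x)]
  refine κ.pos _ fun h => hv ((hα.bijective_comp_horizontalLift (B.basePoint x)).1 (h.trans ?_))
  simp

lemma mvfderiv_comp_proj {F : Type*} [NormedAddCommGroup F] [NormedSpace ℝ F] {f : M → F}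
    {x : M} (p : B.Fiber x) (hf : MDifferentiableAt IM 𝓘(ℝ, F) f x) (u : TangentSpace IM x) :
    mvfderiv IP (f ∘ B.proj) p.1 (A.horizontalLift p u) = mvfderiv IM f x u := by
  obtain ⟨p, rfl⟩ := p
  refine (congrArg (fun L : EP →L[ℝ] F => L (A.horizontalLift ⟨p, rfl⟩ u))
    (mfderiv_comp p hf (B.mdifferentiable_proj p))).trans ?_
  exact congrArg (mvfderiv IM f (B.proj p)) (A.dproj_horizontalLift ⟨p, rfl⟩ u)

/-- `α` is an isomorphism on `ker ω` and vanishes on vertical vectors, on which `ω` is an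
isomorphism. So `(α, ω)` is a parallelism of `P`. -/
lemma bijective_form_prod (hα : A.IsIsoOnHorizontal α) (p : P) :
    Bijective ((α.form p).prod (A.form p)) := by
  let p' : B.Fiber (B.proj p) := ⟨p, rfl⟩
  constructor
  · rw [injective_iff_map_eq_zero]
    intro v hv
    have h1 : α.form p v = 0 := congrArg Prod.fst hv
    have h2 : A.form p v = 0 := congrArg Prod.snd hv
    have h3 : (⟨v, h2⟩ : A.horizontal p) = 0 := (hα p).1 (by simpa using h1)
    exact congrArg Subtype.val h3
  · rintro ⟨X, Y⟩
    obtain ⟨w, hw⟩ := (hα p).2 X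
    have h1 : α.form p (B.fundamental p Y) = 0 := α.form_vertical p _ (B.dproj_fundamental p' Y)
    have h2 : A.form p w.1 = 0 := w.2
    refine ⟨w.1 + B.fundamental p Y, Prod.ext ?_ ?_⟩
    · change α.form p _ = X
      rw [map_add, h1, add_zero]
      exact hw
    · change A.form p _ = Y
      rw [map_add, h2, A.form_fundamental, zero_add]

lemma form_horizontalProj (p : P) (ζ : TangentSpace IP p) :
    α.form p (A.horizontalProj p ζ) = α.form p ζ := by
  change α.form p (ζ - B.fundamental p (A.form p ζ)) = _
  rw [map_sub, α.form_vertical p _ (B.dproj_fundamental (⟨p, rfl⟩ : B.Fiber (B.proj p)) _),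
    sub_zero]

end Connection

variable [FiniteDimensional ℝ EK] [FiniteDimensional ℝ EP] [FiniteDimensional ℝ EM]
  [IsManifold IM ∞ M]

namespace Connection

variable {A : Connection B} {α : TensorialOneForm B} (hα : A.IsIsoOnHorizontal α)

variable (A) in
lemma contMDiffAt_form_liftField (α : TensorialOneForm B) {Z : (x : M) → TangentSpace IM x} {p : P}
    (hZ : ContMDiffAt IM IM.tangent ∞ (fun y => (⟨y, Z y⟩ : TangentBundle IM M)) (B.proj p)) :
    ContMDiffAt IP 𝓘(ℝ, EK) ∞ (fun q => α.form q (A.liftField Z q)) p :=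
  (α.contMDiff _).comp p (A.contMDiffAt_liftField hZ)

variable (A) in
lemma mdifferentiableAt_form_liftField (α : TensorialOneForm B)
    {Z : (x : M) → TangentSpace IM x} {p : P}
    (hZ : MDifferentiableAt IM IM.tangent (fun y => (⟨y, Z y⟩ : TangentBundle IM M)) (B.proj p)) :
    MDifferentiableAt IP 𝓘(ℝ, EK) (fun q => α.form q (A.liftField Z q)) p :=
  (α.contMDiff.mdifferentiable (by simp) _).comp p (A.mdifferentiableAt_liftField hZ)

/-! ### The metric -/

lemma pullbackMetric_section (κ : AdInvariantInner IK K) (Y Z : (x : M) → TangentSpace IM x)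
    {x : M} (p : B.Fiber x) :
    pullbackMetric hα κ x (Y x) (Z x)
      = κ.form (α.form p.1 (A.liftField Y p.1)) (α.form p.1 (A.liftField Z p.1)) := by
  rw [pullbackMetric_eq hα κ p, liftField_eq, liftField_eq]

lemma contMDiffAt_pullbackMetric (κ : AdInvariantInner IK K) {Y Z : (x : M) → TangentSpace IM x}
    {x : M} (hY : ContMDiffAt IM IM.tangent ∞ (fun y => (⟨y, Y y⟩ : TangentBundle IM M)) x)
    (hZ : ContMDiffAt IM IM.tangent ∞ (fun y => (⟨y, Z y⟩ : TangentBundle IM M)) x) :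
    ContMDiffAt IM 𝓘(ℝ, ℝ) ∞ (fun y => pullbackMetric hα κ y (Y y) (Z y)) x := by
  obtain ⟨p, rfl⟩ := B.basePoint x
  obtain ⟨s, hs, hsp, hs'⟩ := exists_contMDiffAt_section B p
  have h1 : ContMDiffAt IP 𝓘(ℝ, ℝ) ∞ (fun q => κ.form.toContinuousBilinearMap
      (α.form q (A.liftField Y q)) (α.form q (A.liftField Z q))) p :=
    (contMDiffAt_const.clm_apply (A.contMDiffAt_form_liftField α hY)).clm_apply
      (A.contMDiffAt_form_liftField α hZ)
  -- The function on `P` is `g_α(Y, Z) ∘ π`; composed with the section `s` it gives back `g_α(Y, Z)`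
  -- near the point.
  refine (h1.comp_of_eq hs hsp).congr_of_eventuallyEq ?_
  filter_upwards [hs'] with y hy
  exact pullbackMetric_section hα κ Y Z (⟨s y, hy⟩ : B.Fiber y)

lemma mdifferentiableAt_pullbackMetric (κ : AdInvariantInner IK K)
    {Y Z : (x : M) → TangentSpace IM x} {x : M}
    (hY : MDifferentiableAt IM IM.tangent (fun y => (⟨y, Y y⟩ : TangentBundle IM M)) x)
    (hZ : MDifferentiableAt IM IM.tangent (fun y => (⟨y, Z y⟩ : TangentBundle IM M)) x) :
    MDifferentiableAt IM 𝓘(ℝ, ℝ) (fun y => pullbackMetric hα κ y (Y y) (Z y)) x := by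
  obtain ⟨p, rfl⟩ := B.basePoint x
  obtain ⟨s, hs, hsp, hs'⟩ := exists_contMDiffAt_section B p
  have h1 : MDifferentiableAt IP 𝓘(ℝ, ℝ) (fun q => κ.form.toContinuousBilinearMap
      (α.form q (A.liftField Y q)) (α.form q (A.liftField Z q))) p :=
    (mdifferentiableAt_const.clm_apply (A.mdifferentiableAt_form_liftField α hY)).clm_apply
      (A.mdifferentiableAt_form_liftField α hZ)
  refine (MDifferentiableAt.comp_of_eq (B.proj p) h1 (hs.mdifferentiableAt (by simp)) hsp
    ).congr_of_eventuallyEq ?_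
  filter_upwards [hs'] with y hy
  exact pullbackMetric_section hα κ Y Z (⟨s y, hy⟩ : B.Fiber y)

/-- The metric `g_α` on `T_xM` as a bilinear map. -/
def metricForm (κ : AdInvariantInner IK K) (x : M) :
    TangentSpace IM x →ₗ[ℝ] TangentSpace IM x →ₗ[ℝ] ℝ :=
  (B.adMetric κ x).compl₁₂ (veeEquiv hα x).toLinearMap (veeEquiv hα x).toLinearMap

/-- `g_α` as a smooth Riemannian metric. -/
def riemannianMetric (κ : AdInvariantInner IK K) :
    ContMDiffRiemannianMetric IM ∞ EM (TangentSpace IM : M → Type _) where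
  inner x := 
    let L : EM →ₗ[ℝ] EM →ₗ[ℝ] ℝ := metricForm hα κ x
    L.toContinuousBilinearMap
  symm x v w := by
    change pullbackMetric hα κ x v w = pullbackMetric hα κ x w v
    rw [pullbackMetric_eq hα κ (B.basePoint x), pullbackMetric_eq hα κ (B.basePoint x), κ.symm]
  pos x v hv := pullbackMetric_pos hα κ v hv
  isVonNBounded x := isVonNBounded_of_pos (E := EM) _ fun v hv => pullbackMetric_pos hα κ (x := x) v hv
  contMDiff x := by
    -- A metric is a section of a Hom-bundle with values in a Hom-bundle, so the criterion is used
    -- twice and leaves `g_α(Y, Z)` for `Y`, `Z` constant in a trivialization.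
    refine contMDiffAt_hom_section (V := (TangentSpace IM : M → Type _))
      (W := fun x => TangentSpace IM x →L[ℝ] ℝ) _ x fun b => ?_
    refine contMDiffAt_hom_section (V := (TangentSpace IM : M → Type _)) (W := Bundle.Trivial M ℝ)
      _ x fun c => ?_
    refine (contMDiffAt_section x).2 ?_
    exact contMDiffAt_pullbackMetric hα κ (contMDiffAt_trivialization_symm x b le_rfl)
      (contMDiffAt_trivialization_symm x c le_rfl)

/-! ### The connection on `TM` -/

lemma pullbackNabla_add {X Y : (x : M) → TangentSpace IM x} {x : M}
    (hX : MDifferentiableAt IM IM.tangent (fun y => (⟨y, X y⟩ : TangentBundle IM M)) x)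
    (hY : MDifferentiableAt IM IM.tangent (fun y => (⟨y, Y y⟩ : TangentBundle IM M)) x)
    (u : TangentSpace IM x) :
    pullbackNabla hα (X + Y) x u = pullbackNabla hα X x u + pullbackNabla hα Y x u := by
  obtain ⟨p, rfl⟩ := B.basePoint x
  let p' : B.Fiber (B.proj p) := ⟨p, rfl⟩
  apply (hα.bijective_comp_horizontalLift p').1
  have h1 : (fun q => α.form q (A.liftField (X + Y) q))
      = (fun q => α.form q (A.liftField X q)) + fun q => α.form q (A.liftField Y q) := by
    ext q
    simp [liftField]
  simp only [map_add, form_horizontalLift_pullbackNabla]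
  rw [h1, mvfderiv_add (A.mdifferentiableAt_form_liftField α hX)
    (A.mdifferentiableAt_form_liftField α hY)]
  rfl

lemma pullbackNabla_smul {X : (x : M) → TangentSpace IM x} {f : M → ℝ} {x : M}
    (hX : MDifferentiableAt IM IM.tangent (fun y => (⟨y, X y⟩ : TangentBundle IM M)) x)
    (hf : MDifferentiableAt IM 𝓘(ℝ, ℝ) f x) (u : TangentSpace IM x) :
    pullbackNabla hα (f • X) x u = f x • pullbackNabla hα X x u + mvfderiv IM f x u • X x := by
  obtain ⟨p, rfl⟩ := B.basePoint x
  let p' : B.Fiber (B.proj p) := ⟨p, rfl⟩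
  apply (hα.bijective_comp_horizontalLift p').1
  -- Lifting is fibrewise linear, so `f • X` corresponds to `(f ∘ π) • f_X`, and the derivative of
  -- `f ∘ π` along `ũ` is `df(u)`.
  have h1 : (fun q => α.form q (A.liftField (f • X) q))
      = (f ∘ B.proj) • fun q => α.form q (A.liftField X q) := by
    ext q
    simp [liftField]
  have hf' : MDifferentiableAt IP 𝓘(ℝ, ℝ) (f ∘ B.proj) p := hf.comp p (B.mdifferentiable_proj p)
  simp only [map_add, map_smul, form_horizontalLift_pullbackNabla]
  rw [h1, mvfderiv_smul hf' (A.mdifferentiableAt_form_liftField α hX), add_apply,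
    ContinuousLinearMap.smulRight_apply, mvfderiv_comp_proj p' hf]
  rfl

/-- `∇` as a covariant derivative on `TM`. -/
def covariantDerivative : CovariantDerivative IM EM (TangentSpace IM : M → Type _) where
  toFun X x :=
    let L : EM →ₗ[ℝ] EM := pullbackNabla hα X x
    L.toContinuousLinearMap
  isCovariantDerivativeOnUniv :=
    { add := fun hX hY _ => ContinuousLinearMap.ext (pullbackNabla_add hα hX hY)
      leibniz := fun hX hf _ => ContinuousLinearMap.ext (pullbackNabla_smul hα hX hf) }

lemma covariantDerivative_apply (X : (x : M) → TangentSpace IM x) (x : M) (u : TangentSpace IM x) :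
    covariantDerivative hα X x u = pullbackNabla hα X x u := rfl

/-- The horizontal lift of `∇_Z X` has the smooth `(α, ω)`-values `(Z̃(f_X), 0)`, so it is smooth.
Restricting it to a local section and projecting by `π_*` gives `∇_Z X`. -/
lemma contMDiffAt_pullbackNabla {X Z : (x : M) → TangentSpace IM x} {x : M}
    (hX : ContMDiffAt IM IM.tangent ∞ (fun y => (⟨y, X y⟩ : TangentBundle IM M)) x)
    (hZ : ContMDiffAt IM IM.tangent ∞ (fun y => (⟨y, Z y⟩ : TangentBundle IM M)) x) :
    ContMDiffAt IM IM.tangent ∞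
      (fun y => (⟨y, pullbackNabla hα X y (Z y)⟩ : TangentBundle IM M)) x := by
  obtain ⟨p, rfl⟩ := B.basePoint x
  obtain ⟨s, hs, hsp, hs'⟩ := exists_contMDiffAt_section B p
  set W : (x : M) → TangentSpace IM x := fun y => pullbackNabla hα X y (Z y)
  have h1 : ContMDiffAt IP IP.tangent ∞
      (fun q => (⟨q, A.liftField W q⟩ : TangentBundle IP P)) p := by
    refine contMDiffAt_of_form_apply (β := fun q => (α.form q).prod (A.form q)) le_rfl
      (fun v => (α.contMDiff _).prodMk_space (A.contMDiff _)) (bijective_form_prod hα p) ?_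
    have h2 : (fun q => ((α.form q).prod (A.form q)) (A.liftField W q)) = fun q =>
        (mvfderiv IP (fun q => α.form q (A.liftField X q)) q (A.liftField Z q), (0 : EK)) := by
      ext q : 1
      refine Prod.ext ?_ (A.form_liftField W q)
      exact form_horizontalLift_pullbackNabla hα X (⟨q, rfl⟩ : B.Fiber (B.proj q)) _
    rw [h2]
    exact (contMDiffAt_mvfderiv_apply (A.contMDiffAt_form_liftField α hX)
      (A.contMDiffAt_liftField hZ) (by simp)).prodMk_space contMDiffAt_const
  have h3 : ContMDiff IP.tangent IM.tangent ∞ (tangentMap IP IM B.proj) :=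
    B.contMDiff_proj.contMDiff_tangentMap (by simp)
  refine ((h3 _).comp (B.proj p) (h1.comp_of_eq hs hsp)).congr_of_eventuallyEq ?_
  filter_upwards [hs'] with y hy
  have h4 : tangentMap IP IM B.proj ⟨s y, A.liftField W (s y)⟩ = ⟨B.proj (s y), W (B.proj (s y))⟩ :=
    congrArg (TotalSpace.mk (B.proj (s y))) (A.mfderiv_proj_liftField W (s y))
  refine Eq.trans ?_ h4.symm
  rw [hy]

lemma contMDiffCovariantDerivative :
    CovariantDerivative.ContMDiffCovariantDerivative (covariantDerivative hα) ∞ := by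
  refine ⟨⟨fun {X} hX x _ => ?_⟩⟩
  rw [contMDiffOn_univ] at hX
  refine ContMDiffAt.contMDiffWithinAt ?_
  refine contMDiffAt_hom_section (V := (TangentSpace IM : M → Type _))
      (W := (TangentSpace IM : M → Type _)) _ x fun b => ?_
  exact contMDiffAt_pullbackNabla hα ((hX x).of_le (by simp))
    (contMDiffAt_trivialization_symm x b le_rfl)

/-- Pulled back to `P`, the claim is the product rule for `⟨f_Y, f_Z⟩` along `ũ`. The form `⟨·,·⟩`
is constant and contributes no derivative. -/
lemma isMetricConnection (κ : AdInvariantInner IK K) :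
    IsMetricConnection (riemannianMetric hα κ) (covariantDerivative hα) := by
  intro x u Y Z hY hZ
  obtain ⟨p, rfl⟩ := B.basePoint x
  let p' : B.Fiber (B.proj p) := ⟨p, rfl⟩
  change mvfderiv IM (fun y => pullbackMetric hα κ y (Y y) (Z y)) (B.proj p) u
    = pullbackMetric hα κ _ (pullbackNabla hα Y _ u) (Z _)
      + pullbackMetric hα κ _ (Y _) (pullbackNabla hα Z _ u)
  rw [← mvfderiv_comp_proj (A := A) p' (mdifferentiableAt_pullbackMetric hα κ hY hZ),
    pullbackMetric_eq hα κ p', pullbackMetric_eq hα κ p', form_horizontalLift_pullbackNabla,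
    form_horizontalLift_pullbackNabla, ← liftField_eq, ← liftField_eq]
  have h1 : (fun y => pullbackMetric hα κ y (Y y) (Z y)) ∘ B.proj
      = fun q => κ.form.toContinuousBilinearMap
      (α.form q (A.liftField Y q)) (α.form q (A.liftField Z q)) := by
    ext q
    exact pullbackMetric_section hα κ Y Z (⟨q, rfl⟩ : B.Fiber (B.proj q))
  rw [h1]
  generalize A.horizontalLift p' u = w
  have hf := A.mdifferentiableAt_form_liftField α (p := p) hY
  have hg := A.mdifferentiableAt_form_liftField α (p := p) hZ
  rw [mvfderiv_bilinear _ hf hg]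
  rfl

/-! ### Torsion -/

variable [IP.Boundaryless] [IM.Boundaryless]

/-- `d_Aα` corresponds to the torsion of `∇` under `∨α`. -/
lemma dA_eq_form_torsion (p : P) (ζ ξ : TangentSpace IP p) :
    A.dA α p ζ ξ = α.form p (A.horizontalLift (⟨p, rfl⟩ : B.Fiber (B.proj p))
      ((covariantDerivative hα).torsion (B.proj p) (mfderiv IP IM B.proj p ζ)
        (mfderiv IP IM B.proj p ξ))) := by
  let p' : B.Fiber (B.proj p) := ⟨p, rfl⟩
  unfold Connection.dA
  rw [horizontalProj_eq, horizontalProj_eq]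
  generalize mfderiv IP IM B.proj p ζ = u
  generalize mfderiv IP IM B.proj p ξ = v
  -- Both sides are tensorial, so they may be computed on any fields extending `u` and `v`, and on
  -- `P` on the horizontal lifts of these.
  obtain ⟨Y, rfl, hY⟩ : ∃ Y : (x : M) → TangentSpace IM x, Y (B.proj p) = u ∧
      MDifferentiableAt IM IM.tangent (fun y => (⟨y, Y y⟩ : TangentBundle IM M)) (B.proj p) :=
    ⟨FiberBundle.extend EM u, FiberBundle.extend_apply_self .., FiberBundle.mdifferentiableAt_extend ..⟩
  obtain ⟨Z, rfl, hZ⟩ : ∃ Z : (x : M) → TangentSpace IM x, Z (B.proj p) = v ∧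
      MDifferentiableAt IM IM.tangent (fun y => (⟨y, Z y⟩ : TangentBundle IM M)) (B.proj p) :=
    ⟨FiberBundle.extend EM v, FiberBundle.extend_apply_self .., FiberBundle.mdifferentiableAt_extend ..⟩
  rw [CovariantDerivative.torsion_apply _ hY hZ, covariantDerivative_apply,
    covariantDerivative_apply]
  simp only [map_sub]
  rw [form_horizontalLift_pullbackNabla hα Z p', form_horizontalLift_pullbackNabla hα Y p']
  have hY' := A.mdifferentiableAt_liftField hY
  have hZ' := A.mdifferentiableAt_liftField hZ
  refine (extDerivOneForm_apply α.form α.contMDiff p (A.liftField Y) (A.liftField Z) hY' hZ').trans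
    ?_
  congr 1
  -- The derivative terms agree already. In the bracket term, `[Ỹ, Z̃]` projects to `[Y, Z]`, so its
  -- horizontal part is the lift of `[Y, Z]`; the vertical part is invisible to `α`.
  have h1 := mfderiv_mlieBracket_of_related (B.contMDiff_proj.of_le ENat.LEInfty.out)
    (A.mfderiv_proj_liftField Y) (A.mfderiv_proj_liftField Z) hY' hZ' hY hZ
  rw [← h1, ← horizontalProj_eq]
  exact (form_horizontalProj p _).symm

/-- The torsion is recovered from `d_Aα` because `π_*` is surjective and `u ↦ α_p(ũ)` is injective.
-/
lemma torsion_eq_zero_iff :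
    (covariantDerivative hα).torsion = 0
      ↔ ∀ (p : P) (ζ ξ : TangentSpace IP p), A.dA α p ζ ξ = 0 := by
  constructor
  · intro h p ζ ξ
    rw [dA_eq_form_torsion hα, h]
    simp
  · intro h
    ext x u v
    obtain ⟨p, rfl⟩ := B.basePoint x
    let p' : B.Fiber (B.proj p) := ⟨p, rfl⟩
    obtain ⟨ζ, rfl⟩ := B.dproj_surjective p' u
    obtain ⟨ξ, rfl⟩ := B.dproj_surjective p' v
    refine (hα.bijective_comp_horizontalLift p').1 ?_
    refine (dA_eq_form_torsion hα p ζ ξ).symm.trans ((h p ζ ξ).trans ?_)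
    simp

end Connection

end Principal

end PrincipalGeometry

end

/-- The first two clauses determine all values of `g` and `cov`, so the existential leaves no
freedom: it says that the given metric and connection are genuine bundled objects. -/
theorem proposition2p1
    {EK : Type*} [NormedAddCommGroup EK] [NormedSpace ℝ EK] [FiniteDimensional ℝ EK]
    {HK : Type*} [TopologicalSpace HK] (IK : ModelWithCorners ℝ EK HK) [IK.Boundaryless]
    {K : Type*} [TopologicalSpace K] [ChartedSpace HK K] [Group K] [LieGroup IK ∞ K]
    {EP : Type*} [NormedAddCommGroup EP] [NormedSpace ℝ EP] [FiniteDimensional ℝ EP]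
    {HP : Type*} [TopologicalSpace HP] (IP : ModelWithCorners ℝ EP HP) [IP.Boundaryless]
    {P : Type*} [TopologicalSpace P] [ChartedSpace HP P] [IsManifold IP ∞ P]
    {EM : Type*} [NormedAddCommGroup EM] [NormedSpace ℝ EM] [FiniteDimensional ℝ EM]
    {HM : Type*} [TopologicalSpace HM] (IM : ModelWithCorners ℝ EM HM) [IM.Boundaryless]
    {M : Type*} [TopologicalSpace M] [ChartedSpace HM M] [IsManifold IM ∞ M]
    (B : PrincipalGeometry.PrincipalBundle IK K IP P IM M)
    (A : PrincipalGeometry.Connection B)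
    (α : PrincipalGeometry.TensorialOneForm B) (hα : A.IsIsoOnHorizontal α)
    (κ : PrincipalGeometry.AdInvariantInner IK K) :
    ∃ (g : Bundle.ContMDiffRiemannianMetric IM ∞ EM (TangentSpace IM : M → Type _))
      (cov : CovariantDerivative IM EM (TangentSpace IM : M → Type _)),
      (∀ (x : M) (u v : TangentSpace IM x),
        g.inner x u v = PrincipalGeometry.Connection.pullbackMetric hα κ x u v) ∧
      (∀ (X : (y : M) → TangentSpace IM y) (x : M) (u : TangentSpace IM x),
        cov X x u = PrincipalGeometry.Connection.pullbackNabla hα X x u) ∧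
      CovariantDerivative.ContMDiffCovariantDerivative cov ∞ ∧
      PrincipalGeometry.IsMetricConnection g cov ∧
      (cov.torsion = 0 ↔ ∀ (p : P) (ζ ξ : TangentSpace IP p), A.dA α p ζ ξ = 0) ∧
      ((∀ (p : P) (ζ ξ : TangentSpace IP p), A.dA α p ζ ξ = 0) →
        PrincipalGeometry.IsLeviCivita g cov) := by
  refine ⟨PrincipalGeometry.Connection.riemannianMetric hα κ,
    PrincipalGeometry.Connection.covariantDerivative hα, fun _ _ _ => rfl, fun _ _ _ => rfl,
    PrincipalGeometry.Connection.contMDiffCovariantDerivative hα,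
    PrincipalGeometry.Connection.isMetricConnection hα κ,
    PrincipalGeometry.Connection.torsion_eq_zero_iff hα, fun h => ?_⟩
  exact PrincipalGeometry.isLeviCivita_of_metric_of_torsion_eq_zero
    (PrincipalGeometry.Connection.isMetricConnection hα κ)
    ((PrincipalGeometry.Connection.torsion_eq_zero_iff hα).2 h)
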